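/- Let $R=\bigoplus_{n\ge 0}R_n$ be a commutative standard graded Noetherian ring, i.e. $R_0$ is a commutative Noetherian ring and $R$ is generated as an $R_0$-algebra by finitely many elements of $R_1$, and let $R_+=\bigoplus_{n>0}R_n$. Assume that $R_0$ is local with maximal ideal $\mathfrak m_0$, and let $M=\bigoplus_{n\in\mathbb Z}M_n$ be a finitely generated graded $R$-module. For ideals $I,J$ of $R$ and an $R$-module $X$ put $$\Gamma_{I,J}(X)=\{x\in X : I^n x\subseteq Jx \text{ for all sufficiently large } n\},$$ let $H^i_{I,J}(-)$ be the $i$-th right derived functor of $\Gamma_{I,J}(-)$ on the category of $R$-modules, and put $cd(I,J,X)=\sup\{i\ge 0 : H^i_{I,J}(X)\neq 0\}$ (with $\sup\emptyset=-\infty$). Then $c:=cd(R_+,\mathfrak m_0R,M)$ is not $+\infty$, and if $c\neq-\infty$ (that is, if some $H^i_{R_+,\mathfrak m_0R}(M)$ is nonzero), then the $R$-module $$H^c_{R_+,\mathfrak m_0R}(M)/\mathfrak m_0H^c_{R_+,\mathfrak m_0R}(M)$$ is Artinian. -/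

import Mathlib

open CategoryTheory

universe u

namespace PairLC

section Torsion

variable {R : Type u} [CommRing R]

/-- The `(I, J)`-torsion submodule
`Γ_{I,J}(M) = {x ∈ M : I ^ n x ⊆ J x for all sufficiently large n}`. -/
def torsion (I J : Ideal R) (M : Type*) [AddCommGroup M] [Module R M] : Submodule R M where
  carrier := {x | ∃ N : ℕ, ∀ n ≥ N, ∀ a ∈ I ^ n, ∃ b ∈ J, a • x = b • x}
  zero_mem' := ⟨0, fun _ _ _ _ => ⟨0, J.zero_mem, by simp⟩⟩
  smul_mem' := by
    rintro r x ⟨N, h⟩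
    refine ⟨N, fun n hn a ha => ?_⟩
    obtain ⟨b, hb, e⟩ := h n hn a ha
    exact ⟨b, hb, by rw [smul_comm a r x, e, smul_comm]⟩
  add_mem' := by
    rintro x y ⟨N, hx⟩ ⟨K, hy⟩
    refine ⟨N + K, fun n hn a ha => ?_⟩
    have ha' : a ∈ I ^ N * I ^ K := by
      rw [← pow_add]
      exact Ideal.pow_le_pow_right hn ha
    refine Submodule.mul_induction_on (C := fun a => ∃ b ∈ J, a • (x + y) = b • (x + y)) ha' ?_ ?_
    · intro p hp q hq
      obtain ⟨b, hb, e⟩ := hx N le_rfl p hp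
      obtain ⟨d, hd, f⟩ := hy K le_rfl q hq
      refine ⟨p * d + b * q - b * d,
        J.sub_mem (J.add_mem (J.mul_mem_left _ hd) (J.mul_mem_right _ hb))
          (J.mul_mem_left _ hd), ?_⟩
      have e1 : ∀ r : R, (r * p) • x = (r * b) • x := fun r => by rw [mul_smul, e, ← mul_smul]
      have f1 : ∀ r : R, (r * q) • y = (r * d) • y := fun r => by rw [mul_smul, f, ← mul_smul]
      have ex := e1 q
      have ed := e1 d
      have fp := f1 p
      have fb := f1 b
      rw [mul_comm q p, mul_comm q b] at ex
      rw [mul_comm d p, mul_comm d b] at ed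
      simp only [smul_add, sub_smul, add_smul]
      rw [ex, ed, fp, fb]
      abel
    · rintro p q ⟨b, hb, e⟩ ⟨d, hd, f⟩
      exact ⟨b + d, J.add_mem hb hd, by rw [add_smul, e, f, ← add_smul]⟩

theorem map_mem_torsion (I J : Ideal R) {M N : Type*} [AddCommGroup M] [Module R M]
    [AddCommGroup N] [Module R N] (f : M →ₗ[R] N) (x : M) (hx : x ∈ torsion I J M) :
    f x ∈ torsion I J N := by
  obtain ⟨K, h⟩ := hx
  refine ⟨K, fun n hn a ha => ?_⟩
  obtain ⟨b, hb, e⟩ := h n hn a ha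
  exact ⟨b, hb, by rw [← map_smul, e, map_smul]⟩

/-- The `(I, J)`-torsion functor `Γ_{I,J}(-)` on the category of all `R`-modules; a linear map is
sent to its restriction. -/
def torsionFunctor (I J : Ideal R) : ModuleCat.{u} R ⥤ ModuleCat.{u} R where
  obj M := ModuleCat.of R (torsion I J M)
  map f := ModuleCat.ofHom (f.hom.restrict (fun x hx => map_mem_torsion I J f.hom x hx))
  map_id _ := rfl
  map_comp _ _ := rfl

instance (I J : Ideal R) : (torsionFunctor I J).Additive where
  map_add := rfl

/-- The local cohomology module `H^i_{I,J}(M)` with respect to the pair of ideals `(I, J)`: the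
`i`-th right derived functor of `Γ_{I,J}(-)`, evaluated at `M`. -/
noncomputable def localCohomology (I J : Ideal R) (i : ℕ) (M : Type u) [AddCommGroup M]
    [Module R M] : ModuleCat.{u} R :=
  ((torsionFunctor I J).rightDerived i).obj (ModuleCat.of R M)

/-- `cd(I, J, M) = sup {i : H^i_{I,J}(M) ≠ 0}`. The value is `⊥` if all these modules vanish and
`⊤` if infinitely many of them are nonzero. -/
noncomputable def cd (I J : Ideal R) (M : Type u) [AddCommGroup M] [Module R M] : WithBot ℕ∞ :=
  ⨆ (i : ℕ) (_ : Nontrivial (localCohomology I J i M)), (i : WithBot ℕ∞)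

end Torsion

section Graded

variable {R : Type u} [CommRing R]

/-- A graded ring `R = ⨁_{n ≥ 0} R_n` is standard graded Noetherian if `R_0` is Noetherian and `R`
is generated as an `R_0`-algebra by finitely many elements of `R_1`. -/
structure IsStandardGraded (𝒜 : ℕ → AddSubgroup R) [GradedRing 𝒜] : Prop where
  noetherian : IsNoetherianRing (𝒜 0)
  generated : ∃ S : Set R, S.Finite ∧ S ⊆ (𝒜 1 : Set R) ∧ Algebra.adjoin (𝒜 0) S = ⊤

/-- The subgroups `ℳ n` make `M` a graded module `M = ⨁_{n ∈ ℤ} M_n` over the graded ring `R`. -/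
structure IsGradedModule (𝒜 : ℕ → AddSubgroup R) {M : Type*} [AddCommGroup M] [Module R M]
    (ℳ : ℤ → AddSubgroup M) : Prop where
  isInternal : DirectSum.IsInternal ℳ
  smul_mem : ∀ (i : ℕ) (j : ℤ), ∀ a ∈ 𝒜 i, ∀ x ∈ ℳ j, a • x ∈ ℳ ((i : ℤ) + j)

/-- The irrelevant ideal `R_+ = ⨁_{n > 0} R_n`. -/
def irrelevant (𝒜 : ℕ → AddSubgroup R) [GradedRing 𝒜] : Ideal R :=
  (HomogeneousIdeal.irrelevant 𝒜).toIdeal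

/-- The extension `𝔪₀R` to `R` of the maximal ideal `𝔪₀` of the local ring `R_0`. -/
def maxExt (𝒜 : ℕ → AddSubgroup R) [GradedRing 𝒜] [IsLocalRing (𝒜 0)] : Ideal R :=
  (IsLocalRing.maximalIdeal (𝒜 0)).map (algebraMap (𝒜 0) R)

end Graded

end PairLC

/-! Write `I = R_+`, `J = 𝔪₀R` and `H^i = H^i_{I,J}`. The grading gives that `R` is Noetherian and
`I + J` is maximal; the rest works for any such pair of ideals and a finitely generated `M`.

Finiteness of `cd`: if `I` has `s` generators, then `H^i = 0` for `i > s`, by induction on the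
generators (`subsingleton_localCohomology_span`). The induction uses that the torsion part of an
injective module is injective and that an injective `E` maps onto its localization at an element.

Top degree: let `J = (a₁, …, a_r)` and `φ : M^r → M`, `φ(m) = ∑ a_k m_k`, with image `JM`. Vanishing
above degree `c` passes from `M` to finitely generated modules with smaller support
(`subsingleton_localCohomology_of_support_subset`), so `H^{c+1}(ker φ) = 0` and `H^c(M^r) → H^c(JM)`
is onto. Hence the image of `H^c(JM)` in `H^c(M)` lies in `J H^c(M)`, and `H^c(M)/J H^c(M)` is a
quotient of a submodule of `H^c(M/JM)`.

Finally, `J` kills `M/JM`, and finitely generated modules killed by `J` have Artinian cohomology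
(`isArtinian_localCohomology`): modulo torsion some `x ∈ I + J` is regular, and Melkersson's
criterion reduces degree `i + 1` to degree `i`. -/

namespace CategoryTheory

/-! ### Injective resolutions by splicing short exact sequences -/

open Limits

variable {C : Type*} [Category* C] [Abelian C]

/-- The cokernel of a monomorphism between short exact sequences is short exact. -/
theorem ShortComplex.shortExact_cokernel {S T : ShortComplex C} (hS : S.ShortExact)
    (hT : T.ShortExact) (φ : S ⟶ T) [Mono φ] : (cokernel φ).ShortExact := by
  have := hS.epi_g
  have := hT.mono_f
  have := hT.epi_g
  let s : ShortComplex.SnakeInput C :=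
    { L₀ := kernel φ
      L₁ := S
      L₂ := T
      L₃ := cokernel φ
      v₀₁ := kernel.ι φ
      v₁₂ := φ
      v₂₃ := cokernel.π φ
      w₀₂ := kernel.condition φ
      w₁₃ := cokernel.condition φ
      h₀ := kernelIsKernel φ
      h₃ := cokernelIsCokernel φ
      L₁_exact := hS.exact
      epi_L₁_g := inferInstance
      L₂_exact := hT.exact
      mono_L₂_f := inferInstance }
  -- The snake sequence starts with the terms of `kernel φ`, all zero; so the connecting map
  -- vanishes and the first map between cokernels is mono.
  have hz : IsZero (kernel φ) := (isZero_zero _).of_iso (kernel.ofMono φ)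
  have hz3 : IsZero (kernel φ).X₃ := ShortComplex.π₃.map_isZero hz
  have h1 : Mono (cokernel φ).f := s.L₂'_exact.mono_g (hz3.eq_of_src _ _)
  have h2 : Epi (cokernel φ).g := by
    have e : T.g ≫ (cokernel.π φ).τ₃ = (cokernel.π φ).τ₂ ≫ (cokernel φ).g :=
      ((cokernel.π φ).comm₂₃).symm
    have h3 : Epi (cokernel.π φ).τ₃ := inferInstanceAs (Epi (ShortComplex.π₃.map (cokernel.π φ)))
    have : Epi ((cokernel.π φ).τ₂ ≫ (cokernel φ).g) := e ▸ epi_comp T.g (cokernel.π φ).τ₃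
    exact epi_of_epi (cokernel.π φ).τ₂ _
  exact ⟨s.L₃_exact⟩

variable (C) in
/-- A sequence of short exact sequences `0 ⟶ Z n ⟶ E n ⟶ Z (n + 1) ⟶ 0` with `E n` injective. -/
structure InjectiveSplice where
  /-- the syzygies -/
  Z : ℕ → C
  /-- the injective objects -/
  E : ℕ → C
  /-- the inclusion of a syzygy -/
  ι : ∀ n, Z n ⟶ E n
  /-- the projection to the next syzygy -/
  π : ∀ n, E n ⟶ Z (n + 1)
  zero : ∀ n, ι n ≫ π n = 0
  shortExact : ∀ n, (ShortComplex.mk (ι n) (π n) (zero n)).ShortExact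
  injective : ∀ n, Injective (E n)

namespace InjectiveSplice

variable (s : InjectiveSplice C)

/-- The cochain complex obtained by splicing. -/
abbrev cocomplex : CochainComplex C ℕ :=
  CochainComplex.of s.E (fun n => s.π n ≫ s.ι (n + 1)) fun n => by
    rw [Category.assoc, ← Category.assoc (s.ι (n + 1)), s.zero, zero_comp, comp_zero]

theorem exact_ι_d (n : ℕ) :
    (ShortComplex.mk (s.ι n) (s.π n ≫ s.ι (n + 1))
      (by rw [← Category.assoc, s.zero, zero_comp])).Exact := by
  have := (s.shortExact (n + 1)).mono_f
  let α : ShortComplex.mk (s.ι n) (s.π n) (s.zero n) ⟶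
      ShortComplex.mk (s.ι n) (s.π n ≫ s.ι (n + 1))
      (by rw [← Category.assoc, s.zero, zero_comp]) :=
    { τ₁ := 𝟙 _
      τ₂ := 𝟙 _
      τ₃ := s.ι (n + 1) }
  have : Mono α.τ₃ := this
  exact (ShortComplex.exact_iff_of_epi_of_isIso_of_mono α).1 (s.shortExact n).exact

theorem exact_d_d (n : ℕ) :
    (ShortComplex.mk (s.π n ≫ s.ι (n + 1)) (s.π (n + 1) ≫ s.ι (n + 1 + 1))
      (by rw [Category.assoc, ← Category.assoc (s.ι (n + 1)), s.zero, zero_comp,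
        comp_zero])).Exact := by
  have := (s.shortExact n).epi_g
  let α : ShortComplex.mk (s.π n ≫ s.ι (n + 1)) (s.π (n + 1) ≫ s.ι (n + 1 + 1))
      (by rw [Category.assoc, ← Category.assoc (s.ι (n + 1)), s.zero, zero_comp,
        comp_zero]) ⟶
      ShortComplex.mk (s.ι (n + 1)) (s.π (n + 1) ≫ s.ι (n + 1 + 1))
      (by rw [← Category.assoc, s.zero, zero_comp]) :=
    { τ₁ := s.π n
      τ₂ := 𝟙 _
      τ₃ := 𝟙 _ }
  have : Epi α.τ₁ := this
  exact (ShortComplex.exact_iff_of_epi_of_isIso_of_mono α).2 (s.exact_ι_d (n + 1))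

theorem exactAt_succ (n : ℕ) : s.cocomplex.ExactAt (n + 1) := by
  rw [HomologicalComplex.exactAt_iff' _ n (n + 1) (n + 1 + 1) (by simp) (by simp)]
  convert s.exact_d_d n using 1
  simp [HomologicalComplex.sc', HomologicalComplex.shortComplexFunctor']

theorem cocomplex_d_zero_one : s.cocomplex.d 0 1 = s.π 0 ≫ s.ι 1 :=
  CochainComplex.of_d s.E (fun n => s.π n ≫ s.ι (n + 1)) 0

theorem ι_comp_d_zero_one : s.ι 0 ≫ s.cocomplex.d 0 1 = 0 := by
  rw [cocomplex_d_zero_one, ← Category.assoc, s.zero, zero_comp]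

theorem exact_ι_d_zero_one :
    (ShortComplex.mk (s.ι 0) (s.cocomplex.d 0 1) s.ι_comp_d_zero_one).Exact := by
  convert s.exact_ι_d 0 using 2
  exact s.cocomplex_d_zero_one

/-- The augmentation of the spliced complex. -/
noncomputable def augmentation : (CochainComplex.single₀ C).obj (s.Z 0) ⟶ s.cocomplex :=
  (CochainComplex.fromSingle₀Equiv s.cocomplex (s.Z 0)).symm ⟨s.ι 0, s.ι_comp_d_zero_one⟩

theorem augmentation_f_zero : s.augmentation.f 0 = s.ι 0 :=
  CochainComplex.fromSingle₀Equiv_symm_apply_f_zero _ _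

/-- The injective resolution obtained by splicing. -/
noncomputable def resolution : InjectiveResolution (s.Z 0) where
  cocomplex := s.cocomplex
  injective := s.injective
  ι := s.augmentation
  quasiIso := ⟨fun n => by
    have : Mono (s.ι 0) := (s.shortExact 0).mono_f
    cases n
    · rw [CochainComplex.quasiIsoAt₀_iff, ShortComplex.quasiIso_iff_of_zeros]
      · refine (ShortComplex.exact_and_mono_f_iff_of_iso ?_).2
          ⟨s.exact_ι_d_zero_one, this⟩
        refine ShortComplex.isoMk (Iso.refl _) (Iso.refl _) (Iso.refl _) ?_ ?_
        · exact (Category.id_comp _).trans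
            (s.augmentation_f_zero.symm.trans (Category.comp_id _).symm)
        · exact (Category.id_comp _).trans (Category.comp_id _).symm
      all_goals rfl
    · rw [quasiIsoAt_iff_exactAt]
      · apply s.exactAt_succ
      · apply CochainComplex.exactAt_succ_single_obj⟩

end InjectiveSplice

/-! ### The horseshoe lemma for injective resolutions -/

section Horseshoe

variable [EnoughInjectives C]

/-- A split short exact sequence of injective objects in which `S` embeds. -/
noncomputable abbrev ShortComplex.under (S : ShortComplex C) : ShortComplex C :=
  ShortComplex.mk (biprod.inl : Injective.under S.X₁ ⟶ Injective.under S.X₁ ⊞ Injective.under S.X₃)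
    biprod.snd biprod.inl_snd

/-- The splitting of `S.under`. -/
noncomputable def ShortComplex.underSplitting (S : ShortComplex C) : S.under.Splitting where
  r := biprod.fst
  s := biprod.inr
  f_r := biprod.inl_fst
  s_g := biprod.inr_snd
  id := biprod.total

/-- The embedding of a short exact sequence in a split short exact sequence of injective
objects. -/
noncomputable abbrev ShortComplex.toUnder (S : ShortComplex C) (hS : S.ShortExact) :
    S ⟶ S.under :=
  have := hS.mono_f
  { τ₁ := Injective.ι S.X₁
    τ₂ := biprod.lift (Injective.factorThru (Injective.ι S.X₁) S.f) (S.g ≫ Injective.ι S.X₃)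
    τ₃ := Injective.ι S.X₃
    comm₁₂ := by
      apply biprod.hom_ext <;> simp
    comm₂₃ := by simp }

theorem ShortComplex.mono_toUnder (S : ShortComplex C) (hS : S.ShortExact) :
    Mono (S.toUnder hS) := by
  have h1 : Mono (S.toUnder hS).τ₁ := Injective.ι_mono S.X₁
  have h3 : Mono (S.toUnder hS).τ₃ := Injective.ι_mono S.X₃
  have := hS.mono_f
  have := S.underSplitting.shortExact.mono_f
  have h2 : Mono (S.toUnder hS).τ₂ :=
    ShortComplex.mono_τ₂_of_exact_of_mono (S.toUnder hS) hS.exact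
  constructor
  intro Z a b hab
  ext
  · exact (cancel_mono (S.toUnder hS).τ₁).1 (congr_arg ShortComplex.Hom.τ₁ hab)
  · exact (cancel_mono (S.toUnder hS).τ₂).1 (congr_arg ShortComplex.Hom.τ₂ hab)
  · exact (cancel_mono (S.toUnder hS).τ₃).1 (congr_arg ShortComplex.Hom.τ₃ hab)

/-- The iterated syzygies of a short exact sequence. -/
noncomputable def ShortComplex.syzygies (S : ShortComplex C) (hS : S.ShortExact) :
    ℕ → {T : ShortComplex C // T.ShortExact}
  | 0 => ⟨S, hS⟩
  | n + 1 =>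
    have := ShortComplex.mono_toUnder _ (syzygies S hS n).2
    ⟨cokernel ((syzygies S hS n).1.toUnder (syzygies S hS n).2),
      ShortComplex.shortExact_cokernel (syzygies S hS n).2
        (syzygies S hS n).1.underSplitting.shortExact _⟩

variable (S : ShortComplex C) (hS : S.ShortExact)

/-- The embedding of the `n`-th syzygy of a short exact sequence. -/
noncomputable abbrev ShortComplex.syzygiesι (n : ℕ) :
    (S.syzygies hS n).1 ⟶ (S.syzygies hS n).1.under :=
  (S.syzygies hS n).1.toUnder (S.syzygies hS n).2

/-- The projection to the next syzygy of a short exact sequence. -/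
noncomputable abbrev ShortComplex.syzygiesπ (n : ℕ) :
    (S.syzygies hS n).1.under ⟶ (S.syzygies hS (n + 1)).1 :=
  cokernel.π (S.syzygiesι hS n)

theorem ShortComplex.syzygiesι_comp_syzygiesπ (n : ℕ) :
    S.syzygiesι hS n ≫ S.syzygiesπ hS n = 0 :=
  cokernel.condition _

theorem ShortComplex.shortExact_syzygies (n : ℕ) :
    (ShortComplex.mk (S.syzygiesι hS n) (S.syzygiesπ hS n)
      (S.syzygiesι_comp_syzygiesπ hS n)).ShortExact :=
  have : Mono (S.syzygiesι hS n) := ShortComplex.mono_toUnder _ _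
  have : Epi (S.syzygiesπ hS n) := inferInstanceAs (Epi (cokernel.π _))
  ⟨ShortComplex.exact_cokernel _⟩

/-- The injective splice given by one of the three columns of the horseshoe. -/
noncomputable def ShortComplex.horseshoeSplice (P : ShortComplex C ⥤ C) [P.PreservesZeroMorphisms]
    [PreservesFiniteLimits P] [PreservesFiniteColimits P]
    (hP : ∀ T : ShortComplex C, Injective (P.obj T.under)) : InjectiveSplice C where
  Z n := P.obj (S.syzygies hS n).1
  E n := P.obj (S.syzygies hS n).1.under
  ι n := P.map (S.syzygiesι hS n)
  π n := P.map (S.syzygiesπ hS n)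
  zero n := by rw [← P.map_comp, S.syzygiesι_comp_syzygiesπ, P.map_zero]
  shortExact n := (S.shortExact_syzygies hS n).map_of_exact P
  injective n := hP _

/-- The chain map between two columns of the horseshoe. -/
noncomputable def ShortComplex.horseshoeMap {P Q : ShortComplex C ⥤ C} [P.PreservesZeroMorphisms]
    [PreservesFiniteLimits P] [PreservesFiniteColimits P] [Q.PreservesZeroMorphisms]
    [PreservesFiniteLimits Q] [PreservesFiniteColimits Q]
    (hP : ∀ T : ShortComplex C, Injective (P.obj T.under))
    (hQ : ∀ T : ShortComplex C, Injective (Q.obj T.under)) (α : P ⟶ Q) :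
    (S.horseshoeSplice hS P hP).cocomplex ⟶ (S.horseshoeSplice hS Q hQ).cocomplex :=
  CochainComplex.ofHom (fun n => α.app (S.syzygies hS n).1.under) fun n => by
    have hd : ∀ (s : InjectiveSplice C) (n : ℕ), s.cocomplex.d n (n + 1) = s.π n ≫ s.ι (n + 1) :=
      fun s n => CochainComplex.of_d s.E (fun n => s.π n ≫ s.ι (n + 1)) n
    rw [hd, hd]
    dsimp only [ShortComplex.horseshoeSplice]
    rw [← P.map_comp, ← Q.map_comp]
    exact (α.naturality _).symm

/-- A short exact sequence admits injective resolutions which form a degreewise split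
sequence. -/
theorem ShortComplex.ShortExact.exists_horseshoe {S : ShortComplex C} (hS : S.ShortExact) :
    ∃ (I₁ : InjectiveResolution S.X₁) (I₂ : InjectiveResolution S.X₂)
      (I₃ : InjectiveResolution S.X₃) (φ : I₁.cocomplex ⟶ I₂.cocomplex)
      (ψ : I₂.cocomplex ⟶ I₃.cocomplex) (h : φ ≫ ψ = 0),
      I₁.ι.f 0 ≫ φ.f 0 = S.f ≫ I₂.ι.f 0 ∧ I₂.ι.f 0 ≫ ψ.f 0 = S.g ≫ I₃.ι.f 0 ∧
      ∀ n, Nonempty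
        ((ShortComplex.mk φ ψ h).map (HomologicalComplex.eval C _ n)).Splitting := by
  have h1 : ∀ T : ShortComplex C, Injective (ShortComplex.π₁.obj T.under) :=
    fun T => Injective.injective_under T.X₁
  have h3 : ∀ T : ShortComplex C, Injective (ShortComplex.π₃.obj T.under) :=
    fun T => Injective.injective_under T.X₃
  have h2 : ∀ T : ShortComplex C, Injective (ShortComplex.π₂.obj T.under) :=
    fun T => inferInstanceAs (Injective (Injective.under T.X₁ ⊞ Injective.under T.X₃))
  -- The embeddings into split sequences are iterated in the category of short complexes; the three
  -- projections to `C` are exact, so they turn this single construction into three compatible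
  -- resolutions.
  refine ⟨(S.horseshoeSplice hS ShortComplex.π₁ h1).resolution,
    (S.horseshoeSplice hS ShortComplex.π₂ h2).resolution,
    (S.horseshoeSplice hS ShortComplex.π₃ h3).resolution,
    S.horseshoeMap hS h1 h2 ShortComplex.π₁Toπ₂, S.horseshoeMap hS h2 h3 ShortComplex.π₂Toπ₃,
    ?_, ?_, ?_, fun n => ⟨(S.syzygies hS n).1.underSplitting⟩⟩
  · ext n
    exact (S.syzygies hS n).1.under.zero
  · refine (congrArg (· ≫ _) (InjectiveSplice.augmentation_f_zero _)).trans
      (Eq.trans ?_ (congrArg _ (InjectiveSplice.augmentation_f_zero _)).symm)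
    exact (S.syzygiesι hS 0).comm₁₂
  · refine (congrArg (· ≫ _) (InjectiveSplice.augmentation_f_zero _)).trans
      (Eq.trans ?_ (congrArg _ (InjectiveSplice.augmentation_f_zero _)).symm)
    exact (S.syzygiesι hS 0).comm₂₃

end Horseshoe

/-! ### The long exact sequence and linearity of right derived functors -/

section LongExactSequence

instance Functor.rightDerived_additive {D : Type*} [Category* D] [Abelian D]
    [HasInjectiveResolutions C] (F : C ⥤ D) [F.Additive] (n : ℕ) :
    (F.rightDerived n).Additive where
  map_add {X Y f g} := by
    let I := injectiveResolution X
    let J := injectiveResolution Y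
    have hf := InjectiveResolution.isoRightDerivedObj_hom_naturality f I J
      (InjectiveResolution.desc f J I)
      (InjectiveResolution.desc_commutes_zero f J I) F n
    have hg := InjectiveResolution.isoRightDerivedObj_hom_naturality g I J
      (InjectiveResolution.desc g J I)
      (InjectiveResolution.desc_commutes_zero g J I) F n
    have h := InjectiveResolution.isoRightDerivedObj_hom_naturality (f + g) I J
      (InjectiveResolution.desc f J I + InjectiveResolution.desc g J I)
      ((Preadditive.comp_add _ _ _ _ _ _).trans
        ((congrArg₂ (· + ·) (InjectiveResolution.desc_commutes_zero f J I)
          (InjectiveResolution.desc_commutes_zero g J I)).trans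
            (Preadditive.add_comp _ _ _ f g (J.ι.f 0)).symm)) F n
    rw [← cancel_mono (J.isoRightDerivedObj F n).hom, h, Preadditive.add_comp, hf, hg,
      Functor.map_add, Preadditive.comp_add]

variable [EnoughInjectives C] {D : Type*} [Category* D] [Abelian D] (F : C ⥤ D) [F.Additive]

/-- The long exact sequence of right derived functors. -/
theorem ShortComplex.ShortExact.exists_rightDerived_exact {S : ShortComplex C}
    (hS : S.ShortExact) (n : ℕ) :
    ∃ (δ : (F.rightDerived n).obj S.X₃ ⟶ (F.rightDerived (n + 1)).obj S.X₁)
      (h₁ : δ ≫ (F.rightDerived (n + 1)).map S.f = 0) (h₃ : (F.rightDerived n).map S.g ≫ δ = 0),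
      (S.map (F.rightDerived n)).Exact ∧ (ShortComplex.mk _ _ h₃).Exact ∧
        (ShortComplex.mk _ _ h₁).Exact := by
  obtain ⟨I₁, I₂, I₃, φ, ψ, h, hφ, hψ, hs⟩ := hS.exists_horseshoe
  let T := (ShortComplex.mk φ ψ h).map (F.mapHomologicalComplex (ComplexShape.up ℕ))
  have hT : T.ShortExact := by
    apply HomologicalComplex.shortExact_of_degreewise_shortExact
    intro i
    -- `F` need not be exact, but as an additive functor it preserves splittings.
    exact ((hs i).some.map F).shortExact
  have hn : (ComplexShape.up ℕ).Rel n (n + 1) := by simp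
  let e₁ (k : ℕ) : (F.rightDerived k).obj S.X₁ ≅ T.X₁.homology k := I₁.isoRightDerivedObj F k
  let e₂ (k : ℕ) : (F.rightDerived k).obj S.X₂ ≅ T.X₂.homology k := I₂.isoRightDerivedObj F k
  let e₃ (k : ℕ) : (F.rightDerived k).obj S.X₃ ≅ T.X₃.homology k := I₃.isoRightDerivedObj F k
  have nf (k : ℕ) : (F.rightDerived k).map S.f ≫ (e₂ k).hom =
      (e₁ k).hom ≫ HomologicalComplex.homologyMap T.f k :=
    InjectiveResolution.isoRightDerivedObj_hom_naturality S.f I₁ I₂ φ hφ F k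
  have ng (k : ℕ) : (F.rightDerived k).map S.g ≫ (e₃ k).hom =
      (e₂ k).hom ≫ HomologicalComplex.homologyMap T.g k :=
    InjectiveResolution.isoRightDerivedObj_hom_naturality S.g I₂ I₃ ψ hψ F k
  let δ : (F.rightDerived n).obj S.X₃ ⟶ (F.rightDerived (n + 1)).obj S.X₁ :=
    (e₃ n).hom ≫ hT.δ n (n + 1) hn ≫ (e₁ (n + 1)).inv
  have hδ : δ ≫ (e₁ (n + 1)).hom = (e₃ n).hom ≫ hT.δ n (n + 1) hn := by
    simp [δ]
  have z₁ : δ ≫ (F.rightDerived (n + 1)).map S.f = 0 := by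
    rw [← cancel_mono (e₂ (n + 1)).hom, Category.assoc, nf, ← Category.assoc, hδ, Category.assoc,
      hT.δ_comp, comp_zero, zero_comp]
  have z₃ : (F.rightDerived n).map S.g ≫ δ = 0 := by
    rw [← cancel_mono (e₁ (n + 1)).hom, Category.assoc, hδ, ← Category.assoc, ng, Category.assoc,
      hT.comp_δ, comp_zero, zero_comp]
  refine ⟨δ, z₁, z₃, ?_, ?_, ?_⟩
  · refine ShortComplex.exact_of_iso ?_ (hT.homology_exact₂ n)
    exact (ShortComplex.isoMk (e₁ n) (e₂ n) (e₃ n) (nf n).symm (ng n).symm).symm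
  · refine ShortComplex.exact_of_iso ?_ (hT.homology_exact₃ n (n + 1) hn)
    exact (ShortComplex.isoMk (e₂ n) (e₃ n) (e₁ (n + 1)) (ng n).symm hδ.symm).symm
  · refine ShortComplex.exact_of_iso ?_ (hT.homology_exact₁ n (n + 1) hn)
    exact (ShortComplex.isoMk (e₃ n) (e₁ (n + 1)) (e₂ (n + 1)) hδ.symm (nf (n + 1)).symm).symm

end LongExactSequence

/-- Multiplication by `a` on a resolution lifts multiplication by `a` on `X`. This is what
identifies the maps induced by scalars in the long exact sequences. -/
theorem Functor.rightDerived_map_smul_id {R : Type*} [CommRing R] [CategoryTheory.Linear R C]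
    [HasInjectiveResolutions C] {D : Type*} [Category* D] [Abelian D]
    [CategoryTheory.Linear R D] (F : C ⥤ D)
    [F.Additive] [F.Linear R] (n : ℕ) (X : C) (a : R) :
    (F.rightDerived n).map (a • 𝟙 X) = a • 𝟙 ((F.rightDerived n).obj X) := by
  let I := injectiveResolution X
  have h := InjectiveResolution.isoRightDerivedObj_hom_naturality (a • 𝟙 X) I I
    (a • 𝟙 I.cocomplex)
    ((Linear.comp_smul _ _ _ _ _ _).trans
      ((congrArg (a • ·) ((Category.comp_id _).trans (Category.id_comp _).symm)).trans
        (Linear.smul_comp _ _ _ a (𝟙 X) (I.ι.f 0)).symm)) F n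
  rw [← cancel_mono (I.isoRightDerivedObj F n).hom, h]
  have e : (F.mapHomologicalComplex (ComplexShape.up ℕ)).map (a • 𝟙 I.cocomplex) =
      a • 𝟙 _ := by
    ext k
    simp
  have e' : (F.mapHomologicalComplex (ComplexShape.up ℕ) ⋙
      HomologicalComplex.homologyFunctor D (ComplexShape.up ℕ) n).map (a • 𝟙 I.cocomplex) =
      a • 𝟙 _ := by
    refine (congrArg (HomologicalComplex.homologyFunctor D (ComplexShape.up ℕ) n).map e).trans ?_
    refine (ShortComplex.homologyMap_smul (𝟙 _) a).trans ?_
    exact congrArg (a • ·) (ShortComplex.homologyMap_id _)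
  rw [e']
  simp

end CategoryTheory

namespace PairLC

/-! ### Torsion with respect to a pair of ideals -/

section Torsion

variable {R : Type u} [CommRing R] (I J : Ideal R)

/-- The condition becomes a containment of ideals depending only on the annihilator of `x`; a single
exponent suffices because powers of `I` decrease. -/
theorem mem_torsion_iff {M : Type*} [AddCommGroup M] [Module R M] {x : M} :
    x ∈ torsion I J M ↔ ∃ N : ℕ, I ^ N ≤ J ⊔ Ideal.torsionOf R M x := by
  constructor
  · rintro ⟨N, h⟩
    refine ⟨N, fun a ha => ?_⟩
    obtain ⟨b, hb, e⟩ := h N le_rfl a ha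
    rw [← add_sub_cancel b a]
    refine Submodule.add_mem_sup hb ?_
    rw [Ideal.mem_torsionOf_iff, sub_smul, e, sub_self]
  · rintro ⟨N, h⟩
    refine ⟨N, fun n hn a ha => ?_⟩
    obtain ⟨b, hb, c, hc, rfl⟩ := Submodule.mem_sup.1 (h (Ideal.pow_le_pow_right hn ha))
    rw [Ideal.mem_torsionOf_iff] at hc
    exact ⟨b, hb, by rw [add_smul, hc, add_zero]⟩

theorem mem_torsion_of_injective {M N : Type*} [AddCommGroup M] [Module R M] [AddCommGroup N]
    [Module R N] (f : M →ₗ[R] N) (hf : Function.Injective f) {x : M}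
    (hx : f x ∈ torsion I J N) : x ∈ torsion I J M := by
  obtain ⟨K, h⟩ := hx
  refine ⟨K, fun n hn a ha => ?_⟩
  obtain ⟨b, hb, e⟩ := h n hn a ha
  exact ⟨b, hb, hf (by rw [map_smul, map_smul, e])⟩

theorem torsion_eq_top_of_injective {M N : Type*} [AddCommGroup M] [Module R M] [AddCommGroup N]
    [Module R N] (f : M →ₗ[R] N) (hf : Function.Injective f) (h : torsion I J N = ⊤) :
    torsion I J M = ⊤ :=
  eq_top_iff.2 fun _ _ => mem_torsion_of_injective I J f hf (h ▸ Submodule.mem_top)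

theorem torsion_eq_top_of_surjective {M N : Type*} [AddCommGroup M] [Module R M] [AddCommGroup N]
    [Module R N] (f : M →ₗ[R] N) (hf : Function.Surjective f) (h : torsion I J M = ⊤) :
    torsion I J N = ⊤ := by
  refine eq_top_iff.2 fun x _ => ?_
  obtain ⟨y, rfl⟩ := hf x
  exact map_mem_torsion I J f y (h ▸ Submodule.mem_top)

theorem torsion_torsion (M : Type*) [AddCommGroup M] [Module R M] :
    torsion I J (torsion I J M) = ⊤ :=
  eq_top_iff.2 fun x _ =>
    mem_torsion_of_injective I J (torsion I J M).subtype Subtype.val_injective x.2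

theorem torsion_bot (M : Type*) [AddCommGroup M] [Module R M] : torsion ⊥ J M = ⊤ := by
  refine eq_top_iff.2 fun _ _ => (mem_torsion_iff _ _).2 ⟨1, ?_⟩
  simp

theorem torsion_sup (I₁ I₂ : Ideal R) (M : Type*) [AddCommGroup M] [Module R M] :
    torsion (I₁ ⊔ I₂) J M = torsion I₁ J M ⊓ torsion I₂ J M := by
  ext x
  rw [Submodule.mem_inf, mem_torsion_iff, mem_torsion_iff, mem_torsion_iff]
  constructor
  · rintro ⟨N, h⟩
    exact ⟨⟨N, (Ideal.pow_right_mono le_sup_left N).trans h⟩,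
      ⟨N, (Ideal.pow_right_mono le_sup_right N).trans h⟩⟩
  · rintro ⟨⟨N, h⟩, ⟨K, h'⟩⟩
    exact ⟨N + K, Ideal.sup_pow_add_le_pow_sup_pow.trans (sup_le h h')⟩

theorem mem_torsion_span_singleton_iff (x : R) {M : Type*} [AddCommGroup M] [Module R M] {m : M} :
    m ∈ torsion (Ideal.span {x}) J M ↔ ∃ (n : ℕ) (j : R), j ∈ J ∧ (x ^ n - j) • m = 0 := by
  rw [mem_torsion_iff]
  refine exists_congr fun n => ?_
  rw [Ideal.span_singleton_pow, Ideal.span_singleton_le_iff_mem, Submodule.mem_sup]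
  constructor
  · rintro ⟨j, hj, c, hc, e⟩
    exact ⟨j, hj, by rwa [← e, add_sub_cancel_left, ← Ideal.mem_torsionOf_iff]⟩
  · rintro ⟨j, hj, e⟩
    exact ⟨j, hj, x ^ n - j, by rwa [Ideal.mem_torsionOf_iff], by ring⟩

instance : (torsionFunctor I J).Linear R where
  map_smul _ _ := rfl

instance : Limits.PreservesFiniteLimits (torsionFunctor (R := R) I J) := by
  refine (Functor.preservesFiniteLimits_iff_forall_exact_map_and_mono _).2 ?_
  intro S hS
  have hf := hS.moduleCat_injective_f
  constructor
  · rw [ShortComplex.moduleCat_exact_iff]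
    rintro ⟨x, hx⟩ h
    obtain ⟨y, rfl⟩ := (ShortComplex.moduleCat_exact_iff S).1 hS.exact x (congrArg Subtype.val h)
    exact ⟨⟨y, mem_torsion_of_injective I J S.f.hom hf hx⟩, rfl⟩
  · rw [ModuleCat.mono_iff_injective]
    intro x y h
    exact Subtype.ext (hf (congrArg Subtype.val h))

end Torsion

/-! ### Local cohomology of a pair: functoriality, exact sequence, resolutions -/

section Cohomology

variable {R : Type u} [CommRing R] (I J : Ideal R)

/-- The map induced on local cohomology by a linear map. -/
noncomputable def localCohomologyMap (i : ℕ) {M N : Type u} [AddCommGroup M] [Module R M]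
    [AddCommGroup N] [Module R N] (f : M →ₗ[R] N) :
    localCohomology I J i M →ₗ[R] localCohomology I J i N :=
  (((torsionFunctor I J).rightDerived i).map (ModuleCat.ofHom f)).hom

section Map

variable {M N P : Type u} [AddCommGroup M] [Module R M] [AddCommGroup N] [Module R N]
  [AddCommGroup P] [Module R P] (i : ℕ)

theorem localCohomologyMap_id :
    localCohomologyMap I J i (LinearMap.id : M →ₗ[R] M) = LinearMap.id :=
  congrArg ModuleCat.Hom.hom (((torsionFunctor I J).rightDerived i).map_id (ModuleCat.of R M))

theorem localCohomologyMap_comp (g : N →ₗ[R] P) (f : M →ₗ[R] N) :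
    localCohomologyMap I J i (g ∘ₗ f) = localCohomologyMap I J i g ∘ₗ localCohomologyMap I J i f :=
  congrArg ModuleCat.Hom.hom
    (((torsionFunctor I J).rightDerived i).map_comp (ModuleCat.ofHom f) (ModuleCat.ofHom g))

theorem localCohomologyMap_add (f g : M →ₗ[R] N) :
    localCohomologyMap I J i (f + g) = localCohomologyMap I J i f + localCohomologyMap I J i g :=
  congrArg ModuleCat.Hom.hom
    (((torsionFunctor I J).rightDerived i).map_add (f := ModuleCat.ofHom f)
      (g := ModuleCat.ofHom g))

theorem localCohomologyMap_smul_id (a : R) :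
    localCohomologyMap I J i (a • (LinearMap.id : M →ₗ[R] M)) = a • LinearMap.id :=
  congrArg ModuleCat.Hom.hom
    ((torsionFunctor I J).rightDerived_map_smul_id i (ModuleCat.of R M) a)

theorem localCohomologyMap_smul (a : R) (f : M →ₗ[R] N) :
    localCohomologyMap I J i (a • f) = a • localCohomologyMap I J i f := by
  have h : a • f = (a • LinearMap.id) ∘ₗ f := rfl
  rw [h, localCohomologyMap_comp, localCohomologyMap_smul_id]
  rfl

theorem localCohomologyMap_zero : localCohomologyMap I J i (0 : M →ₗ[R] N) = 0 := by
  have h := localCohomologyMap_smul I J i (0 : R) (0 : M →ₗ[R] N)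
  rwa [zero_smul, zero_smul] at h

theorem localCohomologyMap_sum {ι : Type*} (s : Finset ι) (f : ι → M →ₗ[R] N) :
    localCohomologyMap I J i (∑ k ∈ s, f k) = ∑ k ∈ s, localCohomologyMap I J i (f k) := by
  classical
  induction s using Finset.induction_on with
  | empty => simp [localCohomologyMap_zero]
  | insert a s ha ih => rw [Finset.sum_insert ha, Finset.sum_insert ha, localCohomologyMap_add, ih]

/-- Isomorphic modules have isomorphic local cohomology. -/
noncomputable def localCohomologyCongr (e : M ≃ₗ[R] N) :
    localCohomology I J i M ≃ₗ[R] localCohomology I J i N :=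
  LinearEquiv.ofLinearMap (localCohomologyMap I J i e.toLinearMap)
    (localCohomologyMap I J i e.symm.toLinearMap)
    (by rw [← localCohomologyMap_comp, e.comp_symm, localCohomologyMap_id])
    (by rw [← localCohomologyMap_comp, e.symm_comp, localCohomologyMap_id])

/-- The long exact sequence of local cohomology. -/
theorem exists_localCohomology_exact {f : M →ₗ[R] N} {g : N →ₗ[R] P}
    (hf : Function.Injective f) (hg : Function.Surjective g) (hfg : Function.Exact f g) :
    ∃ δ : localCohomology I J i P →ₗ[R] localCohomology I J (i + 1) M,
      Function.Exact (localCohomologyMap I J i f) (localCohomologyMap I J i g) ∧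
      Function.Exact (localCohomologyMap I J i g) δ ∧
      Function.Exact δ (localCohomologyMap I J (i + 1) f) := by
  let S : ShortComplex (ModuleCat.{u} R) :=
    ShortComplex.mk (ModuleCat.ofHom f) (ModuleCat.ofHom g) (by
      ext x
      exact hfg.apply_apply_eq_zero x)
  have hS : S.ShortExact :=
    have : Mono S.f := (ModuleCat.mono_iff_injective _).2 hf
    have : Epi S.g := (ModuleCat.epi_iff_surjective _).2 hg
    ⟨(ShortComplex.ShortExact.moduleCat_exact_iff_function_exact S).2 hfg⟩
  obtain ⟨δ, h₁, h₃, e₂, e₃, e₁⟩ := hS.exists_rightDerived_exact (torsionFunctor I J) i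
  exact ⟨δ.hom, (ShortComplex.ShortExact.moduleCat_exact_iff_function_exact _).1 e₂,
    (ShortComplex.ShortExact.moduleCat_exact_iff_function_exact _).1 e₃,
    (ShortComplex.ShortExact.moduleCat_exact_iff_function_exact _).1 e₁⟩

end Map

/-- `H^0_{I,J}` is the `(I, J)`-torsion functor. -/
noncomputable def localCohomologyZeroEquiv (M : Type u) [AddCommGroup M] [Module R M] :
    localCohomology I J 0 M ≃ₗ[R] torsion I J M :=
  ((torsionFunctor I J).rightDerivedZeroIsoSelf.app (ModuleCat.of R M)).toLinearEquiv

theorem localCohomologyZeroEquiv_map {M N : Type u} [AddCommGroup M] [Module R M]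
    [AddCommGroup N] [Module R N] (f : M →ₗ[R] N) (x : localCohomology I J 0 M) :
    (localCohomologyZeroEquiv I J N (localCohomologyMap I J 0 f x) : N) =
      f (localCohomologyZeroEquiv I J M x) := by
  have h := (torsionFunctor I J).rightDerivedZeroIsoSelf.hom.naturality (ModuleCat.ofHom f)
  exact congrArg Subtype.val (congrArg (fun φ => φ.hom x) h)

theorem subsingleton_localCohomology_of_injective (i : ℕ) (E : Type u) [AddCommGroup E]
    [Module R E] [Module.Injective R E] : Subsingleton (localCohomology I J (i + 1) E) := by
  have : Injective (ModuleCat.of R E) := Module.injective_object_of_injective_module R E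
  exact ModuleCat.subsingleton_of_isZero
    ((torsionFunctor I J).isZero_rightDerived_obj_injective_succ i (ModuleCat.of R E))

/-- Cohomology is a subquotient of a torsion module, and torsion passes to submodules and quotients.
-/
theorem torsion_localCohomology (i : ℕ) (M : Type u) [AddCommGroup M] [Module R M] :
    torsion I J (localCohomology I J i M) = ⊤ := by
  let Q := injectiveResolution (ModuleCat.of R M)
  let K := ((torsionFunctor I J).mapHomologicalComplex (ComplexShape.up ℕ)).obj Q.cocomplex
  let e : localCohomology I J i M ≅ K.homology i := Q.isoRightDerivedObj (torsionFunctor I J) i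
  have h1 : torsion I J (K.X i) = ⊤ := torsion_torsion I J (Q.cocomplex.X i)
  have h2 : torsion I J (K.cycles i) = ⊤ :=
    torsion_eq_top_of_injective I J (K.iCycles i).hom
      ((ModuleCat.mono_iff_injective _).1 inferInstance) h1
  have h3 : torsion I J (K.homology i) = ⊤ :=
    torsion_eq_top_of_surjective I J (K.homologyπ i).hom
      ((ModuleCat.epi_iff_surjective _).1 inferInstance) h2
  exact torsion_eq_top_of_injective I J e.hom.hom
    ((ModuleCat.mono_iff_injective _).1 inferInstance) h3

/-- Local cohomology is computed by an injective resolution. -/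
theorem exists_resolution (M : Type u) [AddCommGroup M] [Module R M] :
    ∃ (E : ℕ → ModuleCat.{u} R) (d : ∀ n, E n →ₗ[R] E (n + 1)),
      (∀ n, Module.Injective R (E n)) ∧ (∀ n, Function.Exact (d n) (d (n + 1))) ∧
      ∀ (I J : Ideal R) (n : ℕ), Subsingleton (localCohomology I J (n + 1) M) ↔
        ∀ x ∈ torsion I J (E (n + 1)), d (n + 1) x = 0 → ∃ y ∈ torsion I J (E n), d n y = x := by
  let Q := injectiveResolution (ModuleCat.of R M)
  refine ⟨Q.cocomplex.X, fun n => (Q.cocomplex.d n (n + 1)).hom, fun n => ?_, fun n => ?_,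
    fun I J n => ?_⟩
  · have := Q.injective n
    exact Module.injective_module_of_injective_object R (Q.cocomplex.X n)
  · exact (ShortComplex.ShortExact.moduleCat_exact_iff_function_exact _).1 (Q.exact_succ n)
  · let K := ((torsionFunctor I J).mapHomologicalComplex (ComplexShape.up ℕ)).obj Q.cocomplex
    let e : localCohomology I J (n + 1) M ≅ K.homology (n + 1) :=
      Q.isoRightDerivedObj (torsionFunctor I J) (n + 1)
    rw [e.toLinearEquiv.toEquiv.subsingleton_congr, ← ModuleCat.isZero_iff_subsingleton,
      ← HomologicalComplex.exactAt_iff_isZero_homology,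
      HomologicalComplex.exactAt_iff' _ n (n + 1) (n + 1 + 1) (by simp) (by simp),
      ShortComplex.moduleCat_exact_iff]
    constructor
    · intro h x hx hd
      obtain ⟨y, hy⟩ := h ⟨x, hx⟩ (Subtype.ext hd)
      exact ⟨y.1, y.2, congrArg Subtype.val hy⟩
    · rintro h ⟨x, hx⟩ hd
      obtain ⟨y, hy, e⟩ := h x hx (congrArg Subtype.val hd)
      exact ⟨⟨y, hy⟩, Subtype.ext e⟩

end Cohomology

/-! ### Injective modules over a Noetherian ring -/

section Injective

variable {R : Type u} [CommRing R] (I J : Ideal R)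

theorem exists_pow_le_sup_mul {I J a b : Ideal R} (ha : ∃ N : ℕ, I ^ N ≤ J ⊔ a)
    (hb : ∃ N : ℕ, I ^ N ≤ J ⊔ b) : ∃ N : ℕ, I ^ N ≤ J ⊔ a * b := by
  obtain ⟨N, hN⟩ := ha
  obtain ⟨K, hK⟩ := hb
  refine ⟨N + K, ?_⟩
  rw [pow_add]
  refine (Ideal.mul_mono hN hK).trans (Ideal.mul_le.2 fun r hr t ht => ?_)
  obtain ⟨j, hj, x, hx, rfl⟩ := Submodule.mem_sup.1 hr
  obtain ⟨l, hl, y, hy, rfl⟩ := Submodule.mem_sup.1 ht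
  have e : (j + x) * (l + y) = (j * (l + y) + x * l) + x * y := by ring
  rw [e]
  exact Submodule.add_mem_sup (J.add_mem (J.mul_mem_right _ hj) (J.mul_mem_left _ hl))
    (Ideal.mul_mem_mul hx hy)

theorem exists_pow_le_sup_pow {I J a : Ideal R} (ha : ∃ N : ℕ, I ^ N ≤ J ⊔ a) (k : ℕ) :
    ∃ N : ℕ, I ^ N ≤ J ⊔ a ^ k := by
  induction k with
  | zero => exact ⟨0, by simp⟩
  | succ k ih =>
    rw [pow_succ]
    exact exists_pow_le_sup_mul ih ha

/-- Finitely many generators allow one exponent for the whole submodule: the product of their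
annihilators kills it, and `exists_pow_le_sup_mul` handles products. -/
theorem exists_pow_le_sup_annihilator {M : Type*} [AddCommGroup M] [Module R M]
    (S : Submodule R M) (hS : S.FG) (h : S ≤ torsion I J M) :
    ∃ N : ℕ, I ^ N ≤ J ⊔ S.annihilator := by
  revert h
  refine Submodule.fg_induction
    (motive := fun S _ => S ≤ torsion I J M → ∃ N : ℕ, I ^ N ≤ J ⊔ S.annihilator) ?_ ?_ S hS
  · intro x hx
    obtain ⟨N, hN⟩ := (mem_torsion_iff I J).1 (hx (Submodule.mem_span_singleton_self x))
    refine ⟨N, hN.trans (sup_le_sup_left (fun a ha => ?_) J)⟩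
    rw [Submodule.mem_annihilator_span_singleton]
    exact ha
  · intro S₁ S₂ _ _ h₁ h₂ h
    obtain ⟨N, hN⟩ := exists_pow_le_sup_mul (h₁ (le_sup_left.trans h)) (h₂ (le_sup_right.trans h))
    refine ⟨N, hN.trans (sup_le_sup_left ?_ J)⟩
    rw [Submodule.annihilator_sup]
    exact Ideal.mul_le_inf

/-- The `(I, J)`-torsion submodule of an injective module is injective. -/
theorem injective_torsion [IsNoetherianRing R] (E : Type u) [AddCommGroup E] [Module R E]
    [Module.Injective R E] : Module.Injective R (torsion I J E) := by
  refine Module.Baer.injective fun b g => ?_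
  obtain ⟨N, hN⟩ := exists_pow_le_sup_annihilator I J (LinearMap.range g)
    (IsNoetherian.noetherian (⊤ : Submodule R b) |>.map g |> fun h => by rwa [Submodule.map_top] at h)
    (by rw [torsion_torsion]; exact le_top)
  set a := (LinearMap.range g).annihilator with ha
  -- Artin–Rees: `a ^ (k + 1) ⊓ b ≤ a • b`, on which `g` vanishes. So `g` factors through the image
  -- of `b` in `R ⧸ a ^ (k + 1)`.
  obtain ⟨k, hk⟩ := Ideal.exists_pow_inf_eq_pow_smul a (M := R) b
  have hk' : a ^ (k + 1) ⊓ b ≤ a • b := by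
    have h := hk (k + 1) (Nat.le_succ k)
    rw [Ideal.smul_eq_mul, Ideal.mul_top, Nat.add_sub_cancel_left, pow_one] at h
    rw [h]
    exact smul_mono_right _ inf_le_right
  have hab : ∀ x : b, (x : R) ∈ a • b → g x = 0 := by
    rintro ⟨x, hx⟩ h
    have key : ∀ y ∈ a • b, ∃ hy : y ∈ b, g ⟨y, hy⟩ = 0 := by
      intro y hy
      refine Submodule.smul_induction_on (p := fun y => ∃ hy : y ∈ b, g ⟨y, hy⟩ = 0) hy ?_ ?_
      · intro r hr n hn
        refine ⟨b.smul_mem r hn, ?_⟩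
        have : (⟨r • n, b.smul_mem r hn⟩ : b) = r • ⟨n, hn⟩ := rfl
        rw [this, map_smul]
        exact Submodule.mem_annihilator.1 hr _ ⟨_, rfl⟩
      · rintro y z ⟨hy, ey⟩ ⟨hz, ez⟩
        refine ⟨b.add_mem hy hz, ?_⟩
        have : (⟨y + z, b.add_mem hy hz⟩ : b) = ⟨y, hy⟩ + ⟨z, hz⟩ := rfl
        rw [this, map_add, ey, ez, add_zero]
    exact (key x h).2
  let c : Ideal R := a ^ (k + 1)
  let p : Submodule R b := Submodule.comap b.subtype c
  let f : (b ⧸ p) →ₗ[R] R ⧸ c := Submodule.mapQ p c b.subtype le_rfl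
  have hf : Function.Injective f := by
    rw [← LinearMap.ker_eq_bot, Submodule.ker_mapQ]
    simp [p]
  let g₁ : (b ⧸ p) →ₗ[R] E := p.liftQ ((torsion I J E).subtype ∘ₗ g) (by
    intro x hx
    rw [LinearMap.mem_ker, LinearMap.comp_apply, hab x (hk' ⟨hx, x.2⟩), map_zero])
  obtain ⟨h, hh⟩ := Module.Injective.out f hf g₁
  -- The extension to `R ⧸ c` lands in the torsion part automatically: its values are killed by `a ^
  -- (k + 1)`, and `J ⊔ a ^ (k + 1)` contains a power of `I`.
  have hmem : ∀ r : R, h (c.mkQ r) ∈ torsion I J E := by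
    intro r
    obtain ⟨K, hK⟩ := exists_pow_le_sup_pow ⟨N, hN⟩ (k + 1)
    refine (mem_torsion_iff I J).2 ⟨K, hK.trans (sup_le_sup_left (fun s hs => ?_) J)⟩
    rw [Ideal.mem_torsionOf_iff, ← map_smul, ← map_smul]
    have : c.mkQ (s • r) = 0 := (Submodule.Quotient.mk_eq_zero c).2 (Ideal.mul_mem_right r c hs)
    rw [this, map_zero]
  refine ⟨(h ∘ₗ c.mkQ).codRestrict _ hmem, fun x hx => Subtype.ext ?_⟩
  exact hh (p.mkQ ⟨x, hx⟩)

/-- This is surjectivity of `E → E_s`. The annihilators of `s ^ n` in `R` stabilize, so for large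
`n` the rule `s ^ (n + 1) * r ↦ r • s ^ n • w` is well defined on a principal ideal; `w'` is the
value at `1` of an extension to `R`. -/
theorem exists_pow_smul_sub_eq_zero [IsNoetherianRing R] {E : Type u} [AddCommGroup E]
    [Module R E] [Module.Injective R E] (s : R) (w : E) :
    ∃ (w' : E) (n : ℕ), s ^ n • (w - s • w') = 0 := by
  obtain ⟨n, hn⟩ := monotone_stabilizes_iff_noetherian.2 ‹IsNoetherianRing R›
    ⟨fun n => LinearMap.ker (LinearMap.lsmul R R (s ^ n)), monotone_nat_of_le_succ fun n r hr => by
      simp only [LinearMap.mem_ker, LinearMap.lsmul_apply, smul_eq_mul] at hr ⊢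
      rw [pow_succ', mul_assoc, hr, mul_zero]⟩
  have hker : LinearMap.ker (LinearMap.lsmul R R (s ^ (n + 1))) ≤
      LinearMap.ker (LinearMap.toSpanSingleton R E (s ^ n • w)) := by
    intro r hr
    have h : r ∈ LinearMap.ker (LinearMap.lsmul R R (s ^ n)) := by
      have e : LinearMap.ker (LinearMap.lsmul R R (s ^ n)) =
        LinearMap.ker (LinearMap.lsmul R R (s ^ (n + 1))) := hn (n + 1) (Nat.le_succ n)
      rwa [e]
    simp only [LinearMap.mem_ker, LinearMap.lsmul_apply, smul_eq_mul,
      LinearMap.toSpanSingleton_apply] at h ⊢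
    rw [smul_smul, mul_comm, h, zero_smul]
  let p := LinearMap.ker (LinearMap.lsmul R R (s ^ (n + 1)))
  obtain ⟨h, hh⟩ := Module.Injective.out (p.liftQ (LinearMap.lsmul R R (s ^ (n + 1))) le_rfl)
    (LinearMap.ker_eq_bot.1 (Submodule.ker_liftQ_eq_bot _ _ _ le_rfl))
    (p.liftQ (LinearMap.toSpanSingleton R E (s ^ n • w)) hker)
  refine ⟨h 1, n, ?_⟩
  have h1 := hh (p.mkQ 1)
  rw [Submodule.mkQ_apply, Submodule.liftQ_apply, Submodule.liftQ_apply,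
    LinearMap.toSpanSingleton_apply, LinearMap.lsmul_apply, map_smul, one_smul] at h1
  rw [smul_sub, smul_smul, ← pow_succ, h1, sub_self]

end Injective

/-! ### Vanishing in high degrees and on torsion modules -/

section Vanishing

variable {R : Type u} [CommRing R] [IsNoetherianRing R] (I J : Ideal R)

theorem subsingleton_localCohomology_span (S : Finset R) (i : ℕ) (hi : S.card < i) (M : Type u)
    [AddCommGroup M] [Module R M] :
    Subsingleton (localCohomology (Ideal.span (S : Set R)) J i M) := by
  classical
  -- One resolution computes cohomology for every pair of ideals, so it is fixed before the
  -- induction on generators.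
  obtain ⟨E, d, hE, hd, hH⟩ := exists_resolution (R := R) M
  induction S using Finset.induction_on generalizing i with
  | empty =>
    obtain ⟨n, rfl⟩ := Nat.exists_eq_succ_of_ne_zero hi.ne'
    rw [Nat.succ_eq_add_one, hH]
    intro x _ hx
    obtain ⟨y, hy⟩ := (hd n x).1 hx
    refine ⟨y, ?_, hy⟩
    rw [Finset.coe_empty, Ideal.span_empty, torsion_bot]
    trivial
  | insert x S hx ih =>
    rw [Finset.card_insert_of_notMem hx] at hi
    obtain ⟨n, rfl⟩ : ∃ n, i = n + 1 + 1 := ⟨i - 2, by omega⟩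
    have h1 := (hH _ _ _).1 (ih (n + 1) (by omega))
    have h2 := (hH _ _ _).1 (ih (n + 1 + 1) (by omega))
    rw [Finset.coe_insert, Ideal.span_insert, sup_comm, hH]
    set I' := Ideal.span (S : Set R)
    intro z hz hdz
    rw [torsion_sup] at hz ⊢
    -- The preimage `y` is torsion only for `I'`. Since `s = x ^ k - j` kills `d y`, the cocycle `s
    -- • y` is some `d w`; dividing `w` by `s` up to `s`-power torsion yields the correction `y - d
    -- w'`, which is killed by `s ^ (m + 1)`.
    obtain ⟨y, hy, rfl⟩ := h2 z hz.1 hdz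
    obtain ⟨k, j, hj, hs⟩ := (mem_torsion_span_singleton_iff J x).1 hz.2
    set s := x ^ k - j with s_def
    obtain ⟨w, hw, hwy⟩ := h1 (s • y) (Submodule.smul_mem _ _ hy) (by rw [map_smul, hs])
    have := hE n
    have := injective_torsion I' J (E n)
    obtain ⟨⟨w', hw'⟩, m, hm⟩ := exists_pow_smul_sub_eq_zero s (⟨w, hw⟩ : torsion I' J (E n))
    have hm' : s ^ m • (w - s • w') = 0 := congrArg Subtype.val hm
    refine ⟨y - d n w', ⟨Submodule.sub_mem _ hy (map_mem_torsion I' J (d n) w' hw'), ?_⟩, ?_⟩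
    -- The witness comes from `x ^ k ≡ s` modulo `J`, hence `x ^ (k * (m + 1)) ≡ s ^ (m + 1)`.
    · refine (mem_torsion_span_singleton_iff J x).2 ⟨k * (m + 1), x ^ (k * (m + 1)) - s ^ (m + 1),
        ?_, ?_⟩
      · rw [pow_mul]
        refine Ideal.mem_of_dvd J (sub_dvd_pow_sub_pow (x ^ k) s (m + 1)) ?_
        rwa [s_def, sub_sub_cancel]
      · have e : s • (y - d n w') = d n (w - s • w') := by
          rw [smul_sub, map_sub, map_smul, hwy]
        rw [sub_sub_cancel, pow_succ, mul_smul, e, ← map_smul, hm', map_zero]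
    · rw [map_sub, (hd n).apply_apply_eq_zero, sub_zero]

theorem exists_forall_subsingleton_localCohomology :
    ∃ s : ℕ, ∀ i, s < i → ∀ (M : Type u) [AddCommGroup M] [Module R M],
      Subsingleton (localCohomology I J i M) := by
  obtain ⟨S, hS⟩ := IsNoetherian.noetherian I
  refine ⟨S.card, fun i hi M _ _ => ?_⟩
  have := subsingleton_localCohomology_span J S i hi M
  rwa [show Ideal.span (S : Set R) = I from hS] at this

theorem exists_injective_of_torsion_eq_top (T : Type u) [AddCommGroup T] [Module R T]
    (hT : torsion I J T = ⊤) :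
    ∃ (E : ModuleCat.{u} R) (f : T →ₗ[R] E), Module.Injective R E ∧ torsion I J E = ⊤ ∧
      Function.Injective f := by
  let E := Injective.under (ModuleCat.of R T)
  have : Injective E := Injective.injective_under (ModuleCat.of R T)
  have : Module.Injective R E :=
    (Module.injective_iff_injective_object R E).2 this
  have hι : Function.Injective (Injective.ι (ModuleCat.of R T)).hom :=
    (ModuleCat.mono_iff_injective _).1 inferInstance
  exact ⟨ModuleCat.of R (torsion I J E), (Injective.ι (ModuleCat.of R T)).hom.codRestrict _
    fun x => map_mem_torsion I J _ x (hT ▸ Submodule.mem_top), injective_torsion I J E,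
    torsion_torsion I J E, fun x y h => hι (congrArg Subtype.val h)⟩

/-- Dimension shifting: `T` embeds in a torsion injective with torsion cokernel. In degree one,
`H^0` is the identity on torsion modules, so it preserves the surjection onto the cokernel. -/
theorem subsingleton_localCohomology_of_torsion_eq_top (i : ℕ) (T : Type u) [AddCommGroup T]
    [Module R T] (hT : torsion I J T = ⊤) : Subsingleton (localCohomology I J (i + 1) T) := by
  induction i generalizing T with
  | zero =>
    obtain ⟨E, f, hE, hE', hf⟩ := exists_injective_of_torsion_eq_top I J T hT
    have hg := Submodule.mkQ_surjective (LinearMap.range f)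
    obtain ⟨δ, -, h₃, h₁⟩ := exists_localCohomology_exact I J 0 hf hg
      (LinearMap.exact_map_mkQ_range f)
    have := subsingleton_localCohomology_of_injective I J 0 E
    refine subsingleton_of_forall_eq 0 fun x => ?_
    obtain ⟨y, rfl⟩ := (h₁ x).1 (Subsingleton.elim _ _)
    refine (h₃ y).2 ?_
    obtain ⟨z, hz⟩ := hg (localCohomologyZeroEquiv I J _ y)
    refine ⟨(localCohomologyZeroEquiv I J _).symm ⟨z, hE' ▸ Submodule.mem_top⟩,
      (localCohomologyZeroEquiv I J _).injective (Subtype.ext ?_)⟩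
    rw [localCohomologyZeroEquiv_map, LinearEquiv.apply_symm_apply, hz]
  | succ i ih =>
    obtain ⟨E, f, hE, hE', hf⟩ := exists_injective_of_torsion_eq_top I J T hT
    have hg := Submodule.mkQ_surjective (LinearMap.range f)
    obtain ⟨δ, -, -, h₁⟩ := exists_localCohomology_exact I J (i + 1) hf hg
      (LinearMap.exact_map_mkQ_range f)
    have := subsingleton_localCohomology_of_injective I J (i + 1) E
    have := ih _ (torsion_eq_top_of_surjective I J _ hg hE')
    have hδ : Function.Surjective δ := fun x => (h₁ x).1 (Subsingleton.elim _ _)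
    exact hδ.subsingleton

end Vanishing

/-! ### Maps from a finitely generated module to `R ⧸ p` -/

section Support

variable {R : Type u} [CommRing R] [IsNoetherianRing R]

/-- A finitely generated module with `p` in its support has a nonzero map to `R ⧸ p`. -/
theorem exists_linearMap_quotient_prime_ne_zero {M : Type*} [AddCommGroup M] [Module R M]
    [Module.Finite R M] (p : PrimeSpectrum R) (hp : p ∈ Module.support R M) :
    ∃ φ : M →ₗ[R] R ⧸ p.asIdeal, φ ≠ 0 := by
  let P : Set (Submodule R M) := {L | Module.annihilator R (M ⧸ L) ≤ p.asIdeal}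
  have hbot : ⊥ ∈ P := by
    have h := Module.annihilator_le_of_mem_support hp
    rwa [← (Submodule.quotEquivOfEqBot (⊥ : Submodule R M) rfl).annihilator_eq] at h
  obtain ⟨L, hL, hmax⟩ := WellFounded.has_min
    (wellFounded_gt : WellFounded ((· > ·) : Submodule R M → Submodule R M → Prop)) P ⟨⊥, hbot⟩
  obtain ⟨m, hm⟩ : ∃ m, m ∉ L := by
    by_contra! h
    have htop : L = ⊤ := eq_top_iff.2 fun x _ => h x
    have : Subsingleton (M ⧸ L) := Submodule.Quotient.subsingleton_iff.2 htop
    refine p.2.ne_top (top_le_iff.1 (le_trans (fun a _ => ?_) hL))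
    exact Module.mem_annihilator.2 fun x => Subsingleton.elim _ _
  -- By maximality of `L`, some `s ∉ p` kills `M ⧸ (L + Rm)`, so multiplication by `s` maps `M ⧸ L`
  -- into `Rn`. The annihilator of `n` lies in `p`, which gives `Rn → R ⧸ p`; the composite sends
  -- `m` to the class of `s`.
  obtain ⟨s, hs, hsp⟩ := SetLike.not_le_iff_exists.1
    (fun h => hmax (L ⊔ R ∙ m) h (by
      refine lt_of_le_of_ne le_sup_left fun e => hm ?_
      rw [e]
      exact Submodule.mem_sup_right (Submodule.mem_span_singleton_self m)) :
      ¬ Module.annihilator R (M ⧸ (L ⊔ R ∙ m)) ≤ p.asIdeal)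
  let n : M ⧸ L := L.mkQ m
  have hsn : ∀ x : M ⧸ L, s • x ∈ R ∙ n := by
    intro x
    obtain ⟨x, rfl⟩ := L.mkQ_surjective x
    have h := Module.mem_annihilator.1 hs ((L ⊔ R ∙ m).mkQ x)
    rw [← map_smul, Submodule.mkQ_apply, Submodule.Quotient.mk_eq_zero] at h
    obtain ⟨l, hl, t, ht, e⟩ := Submodule.mem_sup.1 h
    obtain ⟨r, rfl⟩ := Submodule.mem_span_singleton.1 ht
    rw [← map_smul, ← e, map_add, map_smul,
      show L.mkQ l = 0 from (Submodule.Quotient.mk_eq_zero L).2 hl, zero_add]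
    exact Submodule.smul_mem _ r (Submodule.mem_span_singleton_self n)
  have htor : Ideal.torsionOf R (M ⧸ L) n ≤ p.asIdeal := by
    intro a ha
    rw [Ideal.mem_torsionOf_iff] at ha
    have h : a * s ∈ p.asIdeal := hL (Module.mem_annihilator.2 fun x => by
      obtain ⟨r, hr⟩ := Submodule.mem_span_singleton.1 (hsn x)
      rw [mul_smul, ← hr, smul_comm, ha, smul_zero])
    exact (p.2.mem_or_mem h).resolve_right hsp
  let e := Ideal.quotTorsionOfEquivSpanSingleton R (M ⧸ L) n
  let f : (M ⧸ L) →ₗ[R] (R ∙ n) := (s • LinearMap.id).codRestrict _ hsn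
  refine ⟨Submodule.factor htor ∘ₗ e.symm.toLinearMap ∘ₗ f ∘ₗ L.mkQ, fun h => hsp ?_⟩
  have h1 : e.symm (f n) = Ideal.Quotient.mk _ s := by
    rw [LinearEquiv.symm_apply_eq]
    exact Subtype.ext rfl
  have h2 : Submodule.factor htor (e.symm (f n)) = 0 := congrArg (fun φ => φ m) h
  rw [h1] at h2
  exact Ideal.Quotient.eq_zero_iff_mem.1 h2

end Support

theorem subsingleton_of_exact {A B C : Type*} [Zero C] {f : A → B} {g : B → C}
    (h : Function.Exact f g) [Subsingleton A] [Subsingleton C] : Subsingleton B :=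
  ⟨fun x y => by
    obtain ⟨a, rfl⟩ := (h x).1 (Subsingleton.elim _ _)
    obtain ⟨b, rfl⟩ := (h y).1 (Subsingleton.elim _ _)
    rw [Subsingleton.elim a b]⟩

/-! ### Cohomological dimension and support -/

section CohomologicalDimension

variable {R : Type u} [CommRing R] [IsNoetherianRing R] (I J : Ideal R)

/-- Prime filtration: vanishing of `H^i` is stable under extensions, and the primes involved lie in
the support. -/
theorem subsingleton_localCohomology_of_support (i : ℕ) (N : Type u) [AddCommGroup N] [Module R N]
    [hN : Module.Finite R N]
    (h : ∀ p ∈ Module.support R N, Subsingleton (localCohomology I J i (R ⧸ p.asIdeal))) :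
    Subsingleton (localCohomology I J i N) := by
  revert h
  refine IsNoetherianRing.induction_on_isQuotientEquivQuotientPrime R hN
    (motive := fun N _ _ _ => (∀ p ∈ Module.support R N,
      Subsingleton (localCohomology I J i (R ⧸ p.asIdeal))) →
        Subsingleton (localCohomology I J i N)) ?_ ?_ ?_
  · intro N _ _ _ _ _
    have h : localCohomologyMap I J i (LinearMap.id : N →ₗ[R] N) = 0 := by
      rw [Subsingleton.elim (LinearMap.id : N →ₗ[R] N) 0, localCohomologyMap_zero]
    rw [localCohomologyMap_id] at h
    exact subsingleton_of_forall_eq 0 fun x => LinearMap.congr_fun h x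
  · intro N _ _ _ p e h
    have := h p (by
      rw [e.support_eq, Module.mem_support_iff_of_finite, Ideal.annihilator_quotient])
    exact (localCohomologyCongr I J i e).toEquiv.subsingleton
  · intro N₁ _ _ _ N₂ _ _ _ N₃ _ _ _ f g hf hg hfg h₁ h₃ h
    obtain ⟨δ, h₂, -, -⟩ := exists_localCohomology_exact I J i hf hg hfg
    have := h₁ fun p hp => h p (Module.support_subset_of_injective f hf hp)
    have := h₃ fun p hp => h p (Module.support_subset_of_surjective g hg hp)
    exact subsingleton_of_exact h₂

/-- Vanishing of local cohomology above a given degree depends only on the support. -/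
theorem subsingleton_localCohomology_of_support_subset {M : Type u} [AddCommGroup M] [Module R M]
    [Module.Finite R M] {c : ℕ} (hM : ∀ i, c < i → Subsingleton (localCohomology I J i M))
    (i : ℕ) (hi : c < i) (N : Type u) [AddCommGroup N] [Module R N] [Module.Finite R N]
    (hN : Module.support R N ⊆ Module.support R M) :
    Subsingleton (localCohomology I J i N) := by
  obtain ⟨s, hs⟩ := exists_forall_subsingleton_localCohomology I J
  -- Descending induction on `i`, written as induction on `k`; it starts above the bound `s`, where
  -- everything vanishes.
  suffices H : ∀ k i, s < i + k → c < i → ∀ (N : Type u) [AddCommGroup N] [Module R N]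
      [Module.Finite R N], Module.support R N ⊆ Module.support R M →
        Subsingleton (localCohomology I J i N) from
    H (s + 1) i (by omega) hi N hN
  intro k
  induction k with
  | zero => exact fun i hi _ N _ _ _ _ => hs i hi N
  | succ k ih =>
    intro i hik hi N _ _ _ hN
    refine subsingleton_localCohomology_of_support I J i N fun p hp => ?_
    have hp' := hN hp
    clear hp
    -- Noetherian induction on the prime. For a nonzero `φ : M → R ⧸ p`, the image has no `H^i`
    -- because `H^i(M)` and `H^{i+1}(ker φ)` vanish; the cokernel is supported on primes strictly
    -- containing `p`.
    obtain ⟨q, hq⟩ : ∃ q, q = p.asIdeal := ⟨_, rfl⟩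
    induction q using WellFoundedGT.induction generalizing p with
    | _ q IH =>
      obtain ⟨φ, hφ⟩ := exists_linearMap_quotient_prime_ne_zero p hp'
      have h1 : Subsingleton (localCohomology I J i (LinearMap.range φ)) := by
        obtain ⟨δ, -, h₃, -⟩ := exists_localCohomology_exact I J i
          (LinearMap.ker φ).injective_subtype φ.surjective_rangeRestrict
          (LinearMap.exact_iff.2 (by rw [LinearMap.ker_rangeRestrict, Submodule.range_subtype]))
        have := hM i hi
        have := ih (i + 1) (by omega) (by omega) (LinearMap.ker φ)
          (Module.support_subset_of_injective _ (LinearMap.ker φ).injective_subtype)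
        exact subsingleton_of_exact h₃
      have h2 : Subsingleton
          (localCohomology I J i ((R ⧸ p.asIdeal) ⧸ LinearMap.range φ)) := by
        refine subsingleton_localCohomology_of_support I J i _ fun r hr => ?_
        have hpr : p ≤ r := by
          have := Module.support_subset_of_surjective _ (LinearMap.range φ).mkQ_surjective hr
          rwa [Module.mem_support_iff_of_finite, Ideal.annihilator_quotient] at this
        refine IH r.asIdeal (hq ▸ lt_of_le_of_ne hpr ?_) r (Module.mem_support_mono hpr hp') rfl
        intro e
        obtain ⟨m, hm⟩ : ∃ m, φ m ≠ 0 := by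
          by_contra! h
          exact hφ (LinearMap.ext h)
        obtain ⟨a, ha⟩ := Ideal.Quotient.mk_surjective (φ m)
        -- A lift `a` of a nonzero value of `φ` kills the cokernel but is not in `p`; this excludes
        -- `r = p`.
        have har : a ∈ r.asIdeal := by
          refine Module.annihilator_le_of_mem_support hr (Module.mem_annihilator.2 fun x => ?_)
          obtain ⟨x, rfl⟩ := (LinearMap.range φ).mkQ_surjective x
          obtain ⟨b, rfl⟩ := Ideal.Quotient.mk_surjective x
          rw [← map_smul, Submodule.mkQ_apply, Submodule.Quotient.mk_eq_zero]
          refine ⟨b • m, ?_⟩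
          rw [map_smul, ← ha]
          change Ideal.Quotient.mk p.asIdeal (b * a) = Ideal.Quotient.mk p.asIdeal (a * b)
          rw [mul_comm]
        rw [← e] at har
        exact hm (ha ▸ Ideal.Quotient.eq_zero_iff_mem.2 har)
      obtain ⟨δ, h₂, -, -⟩ := exists_localCohomology_exact I J i
        (LinearMap.range φ).injective_subtype (LinearMap.range φ).mkQ_surjective
        (LinearMap.exact_subtype_mkQ _)
      exact subsingleton_of_exact h₂

end CohomologicalDimension

/-! ### Artinian local cohomology modules -/

/-- **Melkersson's criterion**: a module all of whose elements are killed by a power of `x` is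
Artinian as soon as the kernel of multiplication by `x` is. -/
theorem isArtinian_of_ker_lsmul {R M : Type*} [CommRing R] [AddCommGroup M] [Module R M] (x : R)
    (h : ∀ m : M, ∃ n : ℕ, x ^ n • m = 0) [IsArtinian R (LinearMap.ker (LinearMap.lsmul R M x))] :
    IsArtinian R M := by
  rw [← monotone_stabilizes_iff_artinian]
  intro X
  let K := LinearMap.ker (LinearMap.lsmul R M x)
  -- the part of `K` that comes from `x ^ k`-multiples in a submodule `L`
  let V (L : Submodule R M) (k : ℕ) : Submodule R K :=
    (L.map (LinearMap.lsmul R M (x ^ k))).comap K.subtype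
  have hV : ∀ {L L' : Submodule R M} {k k' : ℕ}, L ≤ L' → k' ≤ k → V L k ≤ V L' k' := by
    rintro L L' k k' hL hk ⟨y, hy⟩ ⟨z, hz, e⟩
    refine ⟨x ^ (k - k') • z, L'.smul_mem _ (hL hz), ?_⟩
    rw [← e]
    simp only [LinearMap.lsmul_apply]
    rw [smul_smul, ← pow_add, Nat.add_sub_cancel' hk]
  -- The diagonal chain `V (X n) n` controls all `k ≥ N` at once; the finitely many `k < N` are
  -- treated separately, so one index `B` serves every `k`.
  obtain ⟨N, hN⟩ := IsArtinian.monotone_stabilizes (R := R) (M := K)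
    ⟨fun n => OrderDual.toDual (V (OrderDual.ofDual (X n)) n), fun n n' hn => hV (X.2 hn) hn⟩
  have hk : ∀ k, ∃ N', ∀ n, N' ≤ n →
      V (OrderDual.ofDual (X N')) k = V (OrderDual.ofDual (X n)) k := by
    intro k
    obtain ⟨N', hN'⟩ := IsArtinian.monotone_stabilizes (R := R) (M := K)
      ⟨fun n => OrderDual.toDual (V (OrderDual.ofDual (X n)) k), fun n n' hn => hV (X.2 hn) le_rfl⟩
    exact ⟨N', hN'⟩
  choose f hf using hk
  let B := N + ∑ k ∈ Finset.range N, f k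
  have hB : ∀ k n, B ≤ n → V (OrderDual.ofDual (X B)) k ≤ V (OrderDual.ofDual (X n)) k := by
    intro k n hn
    rcases lt_or_ge k N with hkN | hkN
    · have h1 : f k ≤ B := (Finset.single_le_sum (f := f) (fun _ _ => Nat.zero_le _)
        (Finset.mem_range.2 hkN)).trans (Nat.le_add_left _ _)
      rw [← hf k B h1, ← hf k n (h1.trans hn)]
    · have h1 : V (OrderDual.ofDual (X N)) N =
          V (OrderDual.ofDual (X (max n k))) (max n k) :=
        hN (max n k) (hkN.trans (le_max_right _ _))
      calc V (OrderDual.ofDual (X B)) k ≤ V (OrderDual.ofDual (X N)) N :=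
            hV (X.2 (Nat.le_add_right _ _)) hkN
        _ = _ := h1
        _ ≤ V (OrderDual.ofDual (X n)) k := hV (X.2 (le_max_left _ _)) (le_max_right _ _)
  refine ⟨B, fun n hn => le_antisymm (X.2 hn) ?_⟩
  change OrderDual.ofDual (X B) ≤ OrderDual.ofDual (X n)
  -- If `x ^ (k + 1)` kills `y`, then `x ^ k • y ∈ K` equals `x ^ k • y'` with `y'` in the smaller
  -- module, and `x ^ k` kills `y - y'`.
  have key : ∀ k, ∀ y ∈ OrderDual.ofDual (X B), x ^ k • y = 0 → y ∈ OrderDual.ofDual (X n) := by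
    intro k
    induction k with
    | zero =>
      intro y _ hy
      rw [pow_zero, one_smul] at hy
      rw [hy]
      exact Submodule.zero_mem _
    | succ k ih =>
      intro y hyB hy
      have hyK : x ^ k • y ∈ K := by
        rw [LinearMap.mem_ker, LinearMap.lsmul_apply, smul_smul, ← pow_succ', hy]
      obtain ⟨y', hy', e⟩ := hB k n hn (show (⟨x ^ k • y, hyK⟩ : K) ∈ _ from ⟨y, hyB, rfl⟩)
      have e' : x ^ k • y' = x ^ k • y := e
      have := ih (y - y') (Submodule.sub_mem _ hyB ((X.2 hn : _ ≤ _) hy')) (by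
        rw [smul_sub, e', sub_self])
      rw [← sub_add_cancel y y']
      exact Submodule.add_mem _ this hy'
  intro y hy
  obtain ⟨k, hk⟩ := h y
  exact key k y hy hk

section Artinian

variable {R : Type u} [CommRing R] (I J : Ideal R)

variable {I J} in
theorem exists_pow_smul_eq_zero_of_mem_torsion {M : Type*} [AddCommGroup M] [Module R M] {m : M}
    (hm : m ∈ torsion I J M) (hJ : ∀ a ∈ J, a • m = 0) {x : R} (hx : x ∈ I ⊔ J) :
    ∃ n : ℕ, x ^ n • m = 0 := by
  obtain ⟨a, ha, b, hb, rfl⟩ := Submodule.mem_sup.1 hx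
  obtain ⟨N, h⟩ := hm
  obtain ⟨c, hc, e⟩ := h N le_rfl (a ^ N) (Ideal.pow_mem_pow ha N)
  refine ⟨N, ?_⟩
  have h1 : (a + b) ^ N - a ^ N ∈ J :=
    Ideal.mem_of_dvd J (sub_dvd_pow_sub_pow (a + b) a N) (by rwa [add_sub_cancel_left])
  have h2 := hJ _ h1
  rwa [sub_smul, e, hJ c hc, sub_zero] at h2

theorem localCohomology_smul_eq_zero (i : ℕ) {N : Type u} [AddCommGroup N] [Module R N] {a : R}
    (h : ∀ m : N, a • m = 0) (x : localCohomology I J i N) : a • x = 0 := by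
  have e := localCohomologyMap_smul_id (M := N) I J i a
  rw [show a • (LinearMap.id : N →ₗ[R] N) = 0 from LinearMap.ext h, localCohomologyMap_zero] at e
  exact (LinearMap.congr_fun e x).symm

variable [IsNoetherianRing R]

/-- In a prime filtration, a factor `R ⧸ p` that is torsion and killed by `J` has `I ⊔ J ≤ p`; so
`p` is maximal and the factor is simple. -/
theorem isArtinian_of_torsion_eq_top [hIJ : (I ⊔ J).IsMaximal] (T : Type u) [AddCommGroup T]
    [Module R T] [hT : Module.Finite R T] (h : torsion I J T = ⊤)
    (hJ : ∀ a ∈ J, ∀ m : T, a • m = 0) : IsArtinian R T := by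
  revert h hJ
  refine IsNoetherianRing.induction_on_isQuotientEquivQuotientPrime R hT
    (motive := fun T _ _ _ => torsion I J T = ⊤ → (∀ a ∈ J, ∀ m : T, a • m = 0) → IsArtinian R T)
    ?_ ?_ ?_
  · intro N _ _ _ _ _ _
    infer_instance
  · intro N _ _ _ p e h hJ
    have hle : I ⊔ J ≤ p.asIdeal := by
      intro x hx
      obtain ⟨n, hn⟩ := exists_pow_smul_eq_zero_of_mem_torsion (m := e.symm 1)
        (h ▸ Submodule.mem_top) (fun a ha => hJ a ha _) hx
      rw [← map_smul, LinearEquiv.map_eq_zero_iff] at hn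
      refine p.2.mem_of_pow_mem n (Ideal.Quotient.eq_zero_iff_mem.1 ?_)
      rw [← hn, Algebra.smul_def, mul_one]
      rfl
    have hp : p.asIdeal.IsMaximal := by
      rwa [← hIJ.eq_of_le p.2.ne_top hle]
    have : IsSimpleModule R (R ⧸ p.asIdeal) := by
      rw [isSimpleModule_iff_isCoatom]
      exact hp.out
    exact e.isArtinian_iff.2 inferInstance
  · intro N₁ _ _ _ N₂ _ _ _ N₃ _ _ _ f g hf hg hfg h₁ h₃ h hJ
    have := h₁ (torsion_eq_top_of_injective I J f hf h)
      fun a ha m => hf (by rw [map_smul, hJ a ha, map_zero])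
    have := h₃ (torsion_eq_top_of_surjective I J g hg h) fun a ha m => by
      obtain ⟨m, rfl⟩ := hg m
      rw [← map_smul, hJ a ha, map_zero]
    exact isArtinian_of_range_eq_ker f g (LinearMap.exact_iff.1 hfg).symm

/-- `I m` is finitely generated, so one power of `I` kills it, and the next power kills `m`.
Consequently no nonzero element of `N` modulo torsion is killed by `I`. -/
theorem mem_torsion_of_forall_smul_mem_torsion {N : Type*} [AddCommGroup N] [Module R N]
    [Module.Finite R N] (hJ : ∀ a ∈ J, ∀ m : N, a • m = 0) {m : N}
    (hm : ∀ x ∈ I, x • m ∈ torsion I J N) : m ∈ torsion I J N := by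
  have hle : (I • (R ∙ m)) ≤ torsion I J N := by
    rw [Submodule.smul_le]
    intro r hr n hn
    obtain ⟨t, rfl⟩ := Submodule.mem_span_singleton.1 hn
    rw [smul_comm]
    exact Submodule.smul_mem _ _ (hm r hr)
  obtain ⟨K, hK⟩ := exists_pow_le_sup_annihilator I J _ (IsNoetherian.noetherian _) hle
  refine (mem_torsion_iff I J).2 ⟨K + 1, fun a ha => Ideal.mem_sup_right ?_⟩
  rw [Ideal.mem_torsionOf_iff]
  rw [pow_succ] at ha
  refine Submodule.mul_induction_on (C := fun a => a • m = 0) ha ?_ ?_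
  · intro p hp q hq
    obtain ⟨b, hb, c, hc, rfl⟩ := Submodule.mem_sup.1 (hK hp)
    rw [mul_smul, add_smul, hJ b hb, zero_add]
    exact Submodule.mem_annihilator.1 hc _
      (Submodule.smul_mem_smul hq (Submodule.mem_span_singleton_self m))
  · intro p q hp hq
    rw [add_smul, hp, hq, add_zero]

/-- If `I + J` is maximal, then the local cohomology modules of a finitely generated module killed
by `J` are Artinian. -/
theorem isArtinian_localCohomology [(I ⊔ J).IsMaximal] (i : ℕ) (N : Type u) [AddCommGroup N]
    [Module R N] [Module.Finite R N] (hJ : ∀ a ∈ J, ∀ m : N, a • m = 0) :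
    IsArtinian R (localCohomology I J i N) := by
  induction i generalizing N with
  | zero =>
    have := isArtinian_of_torsion_eq_top I J (torsion I J N) (torsion_torsion I J N)
      fun a ha m => Subtype.ext (hJ a ha m)
    exact (localCohomologyZeroEquiv I J N).isArtinian_iff.2 this
  | succ i ih =>
    let T := torsion I J N
    let N' := N ⧸ T
    have hJ' : ∀ a ∈ J, ∀ m : N', a • m = 0 := fun a ha m => by
      obtain ⟨m, rfl⟩ := T.mkQ_surjective m
      rw [← map_smul, hJ a ha, map_zero]
    obtain ⟨-, hTN, -, -⟩ := exists_localCohomology_exact I J (i + 1) T.injective_subtype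
      T.mkQ_surjective (LinearMap.exact_subtype_mkQ T)
    have hT : Subsingleton (localCohomology I J (i + 1) T) :=
      subsingleton_localCohomology_of_torsion_eq_top I J i T (torsion_torsion I J N)
    have hsub : Subsingleton ((R ⧸ (I ⊔ J)) →ₗ[R] N') := by
      refine subsingleton_of_forall_eq 0 fun φ => ?_
      have h1 : φ 1 = 0 := by
        obtain ⟨m, hm⟩ := T.mkQ_surjective (φ 1)
        rw [← hm]
        refine (Submodule.Quotient.mk_eq_zero T).2
          (mem_torsion_of_forall_smul_mem_torsion I J hJ fun x hx => ?_)
        rw [← Submodule.Quotient.mk_eq_zero T]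
        change T.mkQ (x • m) = 0
        rw [map_smul, hm, ← map_smul, Algebra.smul_def, mul_one]
        exact (congrArg φ (Ideal.Quotient.eq_zero_iff_mem.2 (Ideal.mem_sup_left hx))).trans (map_zero φ)
      refine LinearMap.ext fun y => ?_
      obtain ⟨y, rfl⟩ := Ideal.Quotient.mk_surjective y
      have : Ideal.Quotient.mk (I ⊔ J) y = y • 1 := by
        rw [Algebra.smul_def, mul_one]
        rfl
      rw [this, map_smul, h1, smul_zero, LinearMap.zero_apply]
    -- Over a Noetherian ring, the absence of nonzero maps from `R ⧸ (I ⊔ J)` to the finite module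
    -- `N'` provides an `N'`-regular element of `I ⊔ J`.
    obtain ⟨x, hx, hreg⟩ := IsSMulRegular.subsingleton_linearMap_iff.1 hsub
    rw [Ideal.annihilator_quotient] at hx
    have hN' : IsArtinian R (localCohomology I J (i + 1) N') := by
      have hxinj : Function.Injective (x • (LinearMap.id : N' →ₗ[R] N')) := hreg
      obtain ⟨δ, -, -, h₁⟩ := exists_localCohomology_exact I J i hxinj
        (Submodule.mkQ_surjective (LinearMap.range (x • (LinearMap.id : N' →ₗ[R] N'))))
        (LinearMap.exact_map_mkQ_range _)
      have := ih (N' ⧸ LinearMap.range (x • (LinearMap.id : N' →ₗ[R] N'))) fun a ha m => by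
        obtain ⟨m, rfl⟩ := Submodule.mkQ_surjective _ m
        rw [← map_smul, hJ' a ha, map_zero]
      -- The kernel of `x` on `H^{i+1}(N')` is a quotient of `H^i(N' ⧸ xN')`, Artinian by induction.
      have e : LinearMap.ker (LinearMap.lsmul R (localCohomology I J (i + 1) N') x) =
          LinearMap.range δ := by
        rw [← LinearMap.exact_iff.1 h₁, localCohomologyMap_smul_id]
        rfl
      have : IsArtinian R (LinearMap.ker (LinearMap.lsmul R (localCohomology I J (i + 1) N') x)) := by
        rw [e]
        exact isArtinian_of_surjective _ δ.rangeRestrict δ.surjective_rangeRestrict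
      refine isArtinian_of_ker_lsmul x fun y => ?_
      refine exists_pow_smul_eq_zero_of_mem_torsion (I := I) (J := J) ?_ ?_ hx
      · rw [torsion_localCohomology]
        trivial
      · exact fun a ha => localCohomology_smul_eq_zero I J (i + 1) (hJ' a ha) y
    refine isArtinian_of_injective (localCohomologyMap I J (i + 1) T.mkQ) ?_
    rw [injective_iff_map_eq_zero]
    intro y hy
    obtain ⟨z, rfl⟩ := (hTN y).1 hy
    rw [Subsingleton.elim z 0, map_zero]

end Artinian

/-! ### The top local cohomology module modulo `J` -/

section Top

variable {R : Type u} [CommRing R] (I J : Ideal R)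

theorem subsingleton_localCohomology_of_cd_eq {M : Type u} [AddCommGroup M] [Module R M] {c : ℕ}
    (h : cd I J M = (c : WithBot ℕ∞)) (i : ℕ) (hi : c < i) :
    Subsingleton (localCohomology I J i M) := by
  by_contra hn
  rw [not_subsingleton_iff_nontrivial] at hn
  have h1 : (i : WithBot ℕ∞) ≤ cd I J M :=
    le_iSup₂ (f := fun (i : ℕ) (_ : Nontrivial (localCohomology I J i M)) => (i : WithBot ℕ∞)) i hn
  rw [h] at h1
  exact absurd (Nat.cast_le.1 h1) hi.not_ge

variable [IsNoetherianRing R]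

theorem cd_ne_top (M : Type u) [AddCommGroup M] [Module R M] : cd I J M ≠ ⊤ := by
  obtain ⟨s, hs⟩ := exists_forall_subsingleton_localCohomology I J
  have h : cd I J M ≤ (s : WithBot ℕ∞) := iSup₂_le fun i hi => by
    by_contra hlt
    have := hs i (not_le.1 fun h => hlt (Nat.cast_le.2 h)) M
    exact not_subsingleton _ this
  intro e
  rw [e, top_le_iff] at h
  exact absurd h (WithBot.coe_injective.ne (ENat.natCast_ne_top s))

/-- If `I + J` is maximal, then the top local cohomology module `H` of a finitely generated module
is such that `H ⧸ J H` is Artinian. -/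
theorem isArtinian_top_localCohomology_quotient [(I ⊔ J).IsMaximal] {M : Type u} [AddCommGroup M]
    [Module R M] [Module.Finite R M] {c : ℕ}
    (hM : ∀ i, c < i → Subsingleton (localCohomology I J i M)) :
    IsArtinian R (localCohomology I J c M ⧸ (J • (⊤ : Submodule R (localCohomology I J c M)))) := by
  obtain ⟨S, hS⟩ := IsNoetherian.noetherian J
  let φ : (S → M) →ₗ[R] M := ∑ k : S, (k : R) • LinearMap.proj k
  let L := LinearMap.range φ
  have hJ : ∀ a ∈ J, ∀ m : M ⧸ L, a • m = 0 := by
    intro a ha m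
    obtain ⟨m, rfl⟩ := L.mkQ_surjective m
    rw [← hS] at ha
    induction ha using Submodule.span_induction with
    | mem a ha =>
      classical
      rw [← map_smul, Submodule.mkQ_apply, Submodule.Quotient.mk_eq_zero]
      refine ⟨Pi.single ⟨a, ha⟩ m, ?_⟩
      rw [LinearMap.sum_apply, Finset.sum_eq_single ⟨a, ha⟩]
      · simp
      · intro b _ hb
        simp [Pi.single_eq_of_ne hb]
      · simp
    | zero => rw [zero_smul]
    | add a b _ _ ha hb => rw [add_smul, ha, hb, add_zero]
    | smul r a _ ha => rw [smul_assoc, ha, smul_zero]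
  -- The annihilator of `M` also kills `M^r`, which contains `ker φ`.
  have hsupp : Module.support R (LinearMap.ker φ) ⊆ Module.support R M := by
    refine (Module.support_subset_of_injective _ (LinearMap.ker φ).injective_subtype).trans ?_
    intro p hp
    rw [Module.mem_support_iff_of_finite] at hp ⊢
    refine le_trans (fun a ha => ?_) hp
    exact Module.mem_annihilator.2 fun x => funext fun k => Module.mem_annihilator.1 ha (x k)
  obtain ⟨δ, -, h₃, -⟩ := exists_localCohomology_exact I J c (LinearMap.ker φ).injective_subtype
    φ.surjective_rangeRestrict
    (LinearMap.exact_iff.2 (by rw [LinearMap.ker_rangeRestrict, Submodule.range_subtype]))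
  have := subsingleton_localCohomology_of_support_subset I J hM (c + 1) (Nat.lt_succ_self c)
    (LinearMap.ker φ) hsupp
  obtain ⟨-, hL, -, -⟩ := exists_localCohomology_exact I J c L.injective_subtype L.mkQ_surjective
    (LinearMap.exact_subtype_mkQ L)
  have hker : LinearMap.ker (localCohomologyMap I J c L.mkQ) ≤
      J • (⊤ : Submodule R (localCohomology I J c M)) := by
    intro y hy
    obtain ⟨z, rfl⟩ := (hL y).1 hy
    obtain ⟨w, rfl⟩ := (h₃ z).1 (Subsingleton.elim _ _)
    -- By additivity, `H^c` of this composite is `∑ a_k H^c(proj_k)`, whose values lie in `J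
    -- H^c(M)`.
    have e : L.subtype ∘ₗ φ.rangeRestrict = ∑ k : S, (k : R) • LinearMap.proj k := rfl
    rw [← LinearMap.comp_apply, ← localCohomologyMap_comp, e, localCohomologyMap_sum,
      LinearMap.sum_apply]
    refine Submodule.sum_mem _ fun k _ => ?_
    rw [localCohomologyMap_smul]
    exact Submodule.smul_mem_smul (hS ▸ Submodule.subset_span k.2) Submodule.mem_top
  have hA := isArtinian_localCohomology I J c (M ⧸ L) hJ
  have hA' : IsArtinian R
      (localCohomology I J c M ⧸ LinearMap.ker (localCohomologyMap I J c L.mkQ)) :=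
    isArtinian_of_injective _ (LinearMap.ker_eq_bot.1 (Submodule.ker_liftQ_eq_bot _ _ _ le_rfl) :
      Function.Injective
        ((LinearMap.ker (localCohomologyMap I J c L.mkQ)).liftQ _ le_rfl))
  exact isArtinian_of_surjective _ (Submodule.factor hker) (Submodule.factor_surjective hker)

end Top

/-! ### The irrelevant ideal and the graded case -/

section Graded

variable {R : Type u} [CommRing R] (𝒜 : ℕ → AddSubgroup R) [GradedRing 𝒜]

theorem IsStandardGraded.isNoetherianRing {𝒜 : ℕ → AddSubgroup R} [GradedRing 𝒜]
    (h : IsStandardGraded 𝒜) : IsNoetherianRing R := by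
  obtain ⟨S, hS, -, htop⟩ := h.generated
  have := h.noetherian
  have : Algebra.FiniteType (𝒜 0) R :=
    ⟨Subalgebra.fg_def.2 ⟨S, hS, htop⟩⟩
  exact Algebra.FiniteType.isNoetherianRing (𝒜 0) R

/-- The ideal is the preimage of `𝔪₀` under the surjective projection `R → R_0`. -/
theorem isMaximal_irrelevant_sup_maxExt [IsLocalRing (𝒜 0)] :
    (irrelevant 𝒜 ⊔ maxExt 𝒜).IsMaximal := by
  have hsurj : Function.Surjective (GradedRing.projZeroRingHom' 𝒜) := fun a =>
    ⟨a, GradedRing.projZeroRingHom'_apply_coe 𝒜 a⟩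
  have h : irrelevant 𝒜 ⊔ maxExt 𝒜 =
      (IsLocalRing.maximalIdeal (𝒜 0)).comap (GradedRing.projZeroRingHom' 𝒜) := by
    refine le_antisymm (sup_le ?_ ?_) ?_
    · intro x hx
      have h0 : GradedRing.projZeroRingHom' 𝒜 x = 0 :=
        Subtype.ext ((HomogeneousIdeal.mem_irrelevant_iff 𝒜 x).1 hx)
      rw [Ideal.mem_comap, h0]
      exact Ideal.zero_mem _
    · refine Ideal.map_le_iff_le_comap.2 fun a ha => ?_
      rw [Ideal.mem_comap, Ideal.mem_comap]
      exact (GradedRing.projZeroRingHom'_apply_coe 𝒜 a).symm ▸ ha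
    · intro x hx
      rw [Ideal.mem_comap] at hx
      rw [← sub_add_cancel x (GradedRing.projZeroRingHom' 𝒜 x : R)]
      refine Submodule.add_mem_sup ?_ (Ideal.mem_map_of_mem (algebraMap (𝒜 0) R) hx)
      refine (HomogeneousIdeal.mem_irrelevant_iff 𝒜 _).2 ?_
      have e : GradedRing.projZeroRingHom' 𝒜 (x - (GradedRing.projZeroRingHom' 𝒜 x : R)) = 0 := by
        rw [map_sub, GradedRing.projZeroRingHom'_apply_coe, sub_self]
      exact congrArg Subtype.val e
  rw [h]
  exact Ideal.comap_isMaximal_of_surjective _ hsurj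

end Graded

end PairLC

theorem corollary4p3 {R : Type u} [CommRing R] (𝒜 : ℕ → AddSubgroup R) [GradedRing 𝒜]
    (h𝒜 : PairLC.IsStandardGraded 𝒜) [IsLocalRing (𝒜 0)]
    {M : Type u} [AddCommGroup M] [Module R M] [Module.Finite R M]
    (ℳ : ℤ → AddSubgroup M) (hℳ : PairLC.IsGradedModule 𝒜 ℳ) :
    PairLC.cd (PairLC.irrelevant 𝒜) (PairLC.maxExt 𝒜) M ≠ ⊤ ∧
      ∀ c : ℕ, PairLC.cd (PairLC.irrelevant 𝒜) (PairLC.maxExt 𝒜) M = (c : WithBot ℕ∞) →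
        IsArtinian R
          (PairLC.localCohomology (PairLC.irrelevant 𝒜) (PairLC.maxExt 𝒜) c M ⧸
            (PairLC.maxExt 𝒜 • (⊤ : Submodule R
              (PairLC.localCohomology (PairLC.irrelevant 𝒜) (PairLC.maxExt 𝒜) c M)))) := by
  have := h𝒜.isNoetherianRing
  have := PairLC.isMaximal_irrelevant_sup_maxExt 𝒜
  exact ⟨PairLC.cd_ne_top _ _ M, fun c hc => PairLC.isArtinian_top_localCohomology_quotient _ _
    (PairLC.subsingleton_localCohomology_of_cd_eq _ _ hc)⟩
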